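/- Let $G$ be a finite simple directed acyclic graph with vertex set $V$, and for each $a\in V$ fix a word $\mathrm{pa}(a)$ listing the parents of $a$ without repetition. Let $\mathrm{Cau}(G)$ be the free strict Markov category whose objects are the words over $V$ (the monoidal product $\otimes$ is concatenation, the unit is the empty word) and whose morphisms are generated by the identities, symmetries, duplicates $\delta$, discards $\epsilon$ and one causal mechanism $\kappa_a:\mathrm{pa}(a)\to a$ for each $a\in V$, subject only to the axioms of a strict Markov category. A word is singular if no vertex occurs in it twice. For singular words $t,v$ let $G_{t\to v}$ be the subgraph of $G$ consisting of the vertices in $t$ and $v$ and of all directed paths that end in $v$ and do not pass through or end in $t$ (starting in $t$ is allowed). The causal effect $[v\|t]:t\to v$ is the morphism of $\mathrm{Cau}(G)$ represented by the string diagram with input wires $t$, output wires $v$ and one node $\kappa_i$ for each vertex $i\notin t$ of $G_{t\to v}$, in which the wire of every vertex $i$ of $G_{t\to v}$ (the output of $\kappa_i$ if $i\notin t$, the input wire $i$ if $i\in t$) is copied to all children of $i$ in $G_{t\to v}$ and, if $i\in v$, also to the output $i$ (and is discarded if there are no such copies). For distinct vertices $i,j$, a backward trek from $i$ to $j$ is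 a directed path (with at least one arrow) from $j$ to $i$, or a union of two directed paths $i\leftarrow\cdots\leftarrow k\to\cdots\to j$ that have only their starting vertex $k\neq i,j$ in common. For $X,Y,Z\subseteq V$, a backward trek from some $i\in X$ to some $j\in Y$ is proper if it contains no other vertex of $X$ or of $Y$, and $X$ is backward-$t$-separated from $Y$ by $Z$ if every proper backward trek from $X$ to $Y$ contains a vertex of $Z$. Theorem. Let $u,v,w$ be pairwise disjoint singular words over $V$. Then $[vw\|u]$ is decomposable over $v$, that is, $$[vw\|u]=(1_v\otimes[w\|vu])\circ(\delta_v\otimes 1_u)\circ([v\|u]\otimes 1_u)\circ\delta_u ,$$ if and only if (the set of vertices in) $v$ is backward-$t$-separated from (that of) $w$ by (that of) $u$ in $G$. -/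

import Mathlib

open CategoryTheory MonoidalCategory ComonObj

universe u₀

/-- A simple directed acyclic graph on the vertex type `V`, together with a chosen word `pa v`
listing the parents of each vertex `v` without repetition. -/
structure CausalGraph (V : Type u₀) extends Digraph V where
  acyclic : ∀ v : V, ¬ Relation.TransGen Adj v v
  pa : V → List V
  pa_nodup : ∀ v, (pa v).Nodup
  mem_pa : ∀ {x v : V}, x ∈ pa v ↔ Adj x v

namespace CausalGraph

variable {V : Type u₀}

/-! ### Directed paths, treks and separation -/

/-- `G.IsDirPath x q y`: the vertex sequence `x, q₁, …, qₙ = y` with `n ≥ 1` is a directed path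
from `x` to `y`; `q` lists its vertices after the start `x`. (In an acyclic graph the arrows, and
even the vertices, of such a sequence are automatically distinct.) -/
def IsDirPath (G : CausalGraph V) (x : V) (q : List V) (y : V) : Prop :=
  q ≠ [] ∧ (x :: q).IsChain G.Adj ∧ (x :: q).getLast? = some y

/-- `G.IsBackwardTrek i j l`: `l` lists the vertices of a backward trek from `i` to `j`, that is,
of a directed path from `j` to `i`, or of two directed paths `i ← ⋯ ← k → ⋯ → j` which have only
their starting vertex `k`, distinct from `i` and `j`, in common. -/
inductive IsBackwardTrek (G : CausalGraph V) : V → V → List V → Prop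
  | directed {i j : V} {q : List V} : G.IsDirPath j q i → IsBackwardTrek G i j (j :: q)
  | fork {i j k : V} {p q : List V} : G.IsDirPath k p i → G.IsDirPath k q j →
      k ≠ i → k ≠ j → p.Disjoint q → IsBackwardTrek G i j (k :: (p ++ q))

/-- `l` lists the vertices of a proper backward trek from the set `X` to the set `Y`: a backward
trek from some `i ∈ X` to some `j ∈ Y` containing no other vertex of `X` or of `Y`. -/
def IsProperBackwardTrek (G : CausalGraph V) (X Y : Set V) (l : List V) : Prop :=
  ∃ i ∈ X, ∃ j ∈ Y, G.IsBackwardTrek i j l ∧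
    ∀ z ∈ l, z ≠ i → z ≠ j → z ∉ X ∧ z ∉ Y

/-- `X` is backward-`t`-separated from `Y` by `Z`. -/
def BackwardTSeparated (G : CausalGraph V) (X Y Z : Set V) : Prop :=
  ∀ l : List V, G.IsProperBackwardTrek X Y l → ∃ k ∈ l, k ∈ Z

/-! ### The free Markov category on `G` -/

/-- Formal expressions for morphisms between words, built from identities, compositions, monoidal
products, symmetries, duplicates, discards and the causal mechanisms `κ_a : pa a ⟶ a`. -/
inductive Term (G : CausalGraph V) : List V → List V → Type u₀
  | id (A : List V) : Term G A A
  | comp {A B C : List V} : Term G A B → Term G B C → Term G A C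
  | tensor {A B C D : List V} : Term G A B → Term G C D → Term G (A ++ C) (B ++ D)
  | swap (A B : List V) : Term G (A ++ B) (B ++ A)
  | copy (A : List V) : Term G A (A ++ A)
  | discard (A : List V) : Term G A []
  | mech (a : V) : Term G (G.pa a) [a]

/-- The identity, regarded as a morphism between two words that are equal. -/
def Term.ofEq (G : CausalGraph V) {A B : List V} (h : A = B) : Term G A B :=
  h ▸ Term.id A

/-- The congruence generated by the axioms of a strict Markov category. The expressions `ofEq`
only mediate between words that are equal but not syntactically so. The axioms `copy_tensor`,
`discard_tensor`, `copy_unit`, `discard_unit` reduce the duplicates and discards on words to those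
on letters. -/
inductive Term.Rel (G : CausalGraph V) : ∀ {A B : List V}, Term G A B → Term G A B → Prop
  -- equivalence and congruence
  | refl {A B : List V} (f : Term G A B) : Rel G f f
  | symm {A B : List V} {f g : Term G A B} : Rel G f g → Rel G g f
  | trans {A B : List V} {f g h : Term G A B} : Rel G f g → Rel G g h → Rel G f h
  | comp_congr {A B C : List V} {f f' : Term G A B} {g g' : Term G B C} :
      Rel G f f' → Rel G g g' → Rel G (f.comp g) (f'.comp g')
  | tensor_congr {A B C D : List V} {f f' : Term G A B} {g g' : Term G C D} :
      Rel G f f' → Rel G g g' → Rel G (f.tensor g) (f'.tensor g')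
  -- category
  | id_comp {A B : List V} (f : Term G A B) : Rel G ((Term.id A).comp f) f
  | comp_id {A B : List V} (f : Term G A B) : Rel G (f.comp (Term.id B)) f
  | assoc {A B C D : List V} (f : Term G A B) (g : Term G B C) (h : Term G C D) :
      Rel G ((f.comp g).comp h) (f.comp (g.comp h))
  -- the monoidal product is a functor
  | tensor_id (A B : List V) : Rel G ((Term.id A).tensor (Term.id B)) (Term.id (A ++ B))
  | tensor_comp {A B C A' B' C' : List V} (f : Term G A B) (g : Term G B C)
      (f' : Term G A' B') (g' : Term G B' C') :
      Rel G ((f.tensor f').comp (g.tensor g')) ((f.comp g).tensor (f'.comp g'))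
  -- strict associativity and unitality
  | tensor_assoc {A B C A' B' C' : List V} (f : Term G A A') (g : Term G B B')
      (h : Term G C C') :
      Rel G (((f.tensor g).tensor h).comp (ofEq G (List.append_assoc A' B' C')))
        ((ofEq G (List.append_assoc A B C)).comp (f.tensor (g.tensor h)))
  | unit_tensor {A B : List V} (f : Term G A B) : Rel G ((Term.id []).tensor f) f
  | tensor_unit {A B : List V} (f : Term G A B) :
      Rel G ((f.tensor (Term.id [])).comp (ofEq G (List.append_nil B)))
        ((ofEq G (List.append_nil A)).comp f)
  -- symmetry
  | swap_natural {A B C D : List V} (f : Term G A B) (g : Term G C D) :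
      Rel G ((f.tensor g).comp (Term.swap B D)) ((Term.swap A C).comp (g.tensor f))
  | swap_swap (A B : List V) :
      Rel G ((Term.swap A B).comp (Term.swap B A)) (Term.id (A ++ B))
  | hexagon (A B C : List V) :
      Rel G ((ofEq G (List.append_assoc A B C)).comp
          ((Term.swap A (B ++ C)).comp (ofEq G (List.append_assoc B C A))))
        (((Term.swap A B).tensor (Term.id C)).comp
          ((ofEq G (List.append_assoc B A C)).comp ((Term.id B).tensor (Term.swap A C))))
  -- coassociativity, counitality, cocommutativity
  | copy_assoc (A : List V) :
      Rel G ((Term.copy A).comp (((Term.copy A).tensor (Term.id A)).comp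
          (ofEq G (List.append_assoc A A A))))
        ((Term.copy A).comp ((Term.id A).tensor (Term.copy A)))
  | discard_copy (A : List V) :
      Rel G ((Term.copy A).comp ((Term.discard A).tensor (Term.id A))) (Term.id A)
  | copy_discard (A : List V) :
      Rel G ((Term.copy A).comp (((Term.id A).tensor (Term.discard A)).comp
        (ofEq G (List.append_nil A)))) (Term.id A)
  | copy_swap (A : List V) : Rel G ((Term.copy A).comp (Term.swap A A)) (Term.copy A)
  -- duplicates and discards respect the monoidal product
  | copy_tensor (A B : List V) :
      Rel G (Term.copy (A ++ B))
        (((Term.copy A).tensor (Term.copy B)).comp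
          ((ofEq G (show (A ++ A) ++ (B ++ B) = A ++ ((A ++ B) ++ B) by simp)).comp
            (((Term.id A).tensor ((Term.swap A B).tensor (Term.id B))).comp
              (ofEq G (show A ++ ((B ++ A) ++ B) = (A ++ B) ++ (A ++ B) by simp)))))
  | discard_tensor (A B : List V) :
      Rel G (Term.discard (A ++ B)) ((Term.discard A).tensor (Term.discard B))
  | copy_unit : Rel G (Term.copy []) (Term.id [])
  | discard_unit : Rel G (Term.discard []) (Term.id [])
  -- naturality of discards
  | discard_natural {A B : List V} (f : Term G A B) :
      Rel G (f.comp (Term.discard B)) (Term.discard A)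

instance Term.setoid (G : CausalGraph V) (A B : List V) : Setoid (Term G A B) where
  r := Term.Rel G
  iseqv := ⟨Term.Rel.refl, Term.Rel.symm, Term.Rel.trans⟩

end CausalGraph

/-- The causal theory of `G`: the free Markov category on `G`. Its objects are the words over the
vertices of `G`, its morphisms the expressions modulo the axioms of a strict Markov category. -/
structure Cau {V : Type u₀} (G : CausalGraph V) where
  of ::
  word : List V

namespace Cau

open CausalGraph

variable {V : Type u₀} {G : CausalGraph V}

instance : Category.{u₀} (Cau G) where
  Hom X Y := Quotient (Term.setoid G X.word Y.word)
  id X := Quotient.mk _ (Term.id X.word)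
  comp f g := Quotient.map₂ Term.comp (fun _ _ h _ _ h' => Term.Rel.comp_congr h h') f g
  id_comp f := Quotient.inductionOn f fun f => Quotient.sound (Term.Rel.id_comp f)
  comp_id f := Quotient.inductionOn f fun f => Quotient.sound (Term.Rel.comp_id f)
  assoc f g h := Quotient.inductionOn₃ f g h fun f g h => Quotient.sound (Term.Rel.assoc f g h)

/-- The morphism represented by an expression. -/
def mk {A B : List V} (f : Term G A B) : (of A : Cau G) ⟶ of B :=
  Quotient.mk (Term.setoid G A B) f

theorem sound {A B : List V} {f g : Term G A B} (h : Term.Rel G f g) : mk f = mk g :=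
  Quotient.sound h

theorem mk_comp {A B C : List V} (f : Term G A B) (g : Term G B C) :
    mk (f.comp g) = mk f ≫ mk g := rfl

theorem mk_id (A : List V) : mk (Term.id A : Term G A A) = 𝟙 (of A : Cau G) := rfl

theorem mk_ofEq {A B : List V} (h : A = B) :
    mk (Term.ofEq G h) = eqToHom (congrArg (of (G := G)) h) := by
  subst h; rfl

theorem exists_mk {X Y : Cau G} (f : X ⟶ Y) :
    ∃ t : Term G X.word Y.word, f = mk t := by
  obtain ⟨t, rfl⟩ := Quotient.exists_rep f
  exact ⟨t, rfl⟩

/-- The strict monoidal structure given by concatenation: associators and unitors are identities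
between equal words. -/
instance : MonoidalCategoryStruct (Cau G) where
  tensorObj X Y := of (X.word ++ Y.word)
  tensorUnit := of []
  tensorHom f g := Quotient.map₂ Term.tensor (fun _ _ h _ _ h' => Term.Rel.tensor_congr h h') f g
  whiskerLeft X _ _ f := Quotient.map₂ Term.tensor
    (fun _ _ h _ _ h' => Term.Rel.tensor_congr h h') (mk (Term.id X.word)) f
  whiskerRight f Y := Quotient.map₂ Term.tensor
    (fun _ _ h _ _ h' => Term.Rel.tensor_congr h h') f (mk (Term.id Y.word))
  associator X Y Z := eqToIso (congrArg of (List.append_assoc X.word Y.word Z.word))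
  leftUnitor X := Iso.refl X
  rightUnitor X := eqToIso (congrArg of (List.append_nil X.word))

theorem mk_tensor {A B C D : List V} (f : Term G A B) (g : Term G C D) :
    mk (f.tensor g) = mk f ⊗ₘ mk g := rfl

theorem associator_hom_eq (X Y Z : Cau G) :
    (α_ X Y Z).hom = eqToHom (congrArg of (List.append_assoc X.word Y.word Z.word)) := rfl

theorem associator_inv_eq (X Y Z : Cau G) :
    (α_ X Y Z).inv = eqToHom (congrArg of (List.append_assoc X.word Y.word Z.word).symm) := rfl

theorem leftUnitor_hom_eq (X : Cau G) : (λ_ X).hom = eqToHom (X := 𝟙_ (Cau G) ⊗ X) rfl := rfl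

theorem leftUnitor_inv_eq (X : Cau G) :
    (λ_ X).inv = eqToHom (Y := 𝟙_ (Cau G) ⊗ X) rfl := rfl

theorem rightUnitor_hom_eq (X : Cau G) :
    (ρ_ X).hom = eqToHom (congrArg of (List.append_nil X.word)) := rfl

theorem rightUnitor_inv_eq (X : Cau G) :
    (ρ_ X).inv = eqToHom (congrArg of (List.append_nil X.word).symm) := rfl

theorem eqToHom_tensor_id {X Y : Cau G} (h : X = Y) (Z : Cau G) :
    eqToHom h ⊗ₘ 𝟙 Z = eqToHom (congrArg (· ⊗ Z) h) := by
  subst h; exact sound (Term.Rel.tensor_id _ _)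

theorem id_tensor_eqToHom {X Y : Cau G} (h : X = Y) (Z : Cau G) :
    𝟙 Z ⊗ₘ eqToHom h = eqToHom (congrArg (Z ⊗ ·) h) := by
  subst h; exact sound (Term.Rel.tensor_id _ _)

instance : MonoidalCategory (Cau G) :=
  MonoidalCategory.ofTensorHom
    (id_tensorHom_id := fun X Y => sound (Term.Rel.tensor_id _ _))
    (id_tensorHom := fun _ _ _ _ => rfl)
    (tensorHom_id := fun _ _ => rfl)
    (tensorHom_comp_tensorHom := fun f₁ f₂ g₁ g₂ => by
      obtain ⟨f₁, rfl⟩ := exists_mk f₁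
      obtain ⟨f₂, rfl⟩ := exists_mk f₂
      obtain ⟨g₁, rfl⟩ := exists_mk g₁
      obtain ⟨g₂, rfl⟩ := exists_mk g₂
      exact sound (Term.Rel.tensor_comp _ _ _ _))
    (associator_naturality := fun f g h => by
      obtain ⟨f, rfl⟩ := exists_mk f
      obtain ⟨g, rfl⟩ := exists_mk g
      obtain ⟨h, rfl⟩ := exists_mk h
      have := sound (Term.Rel.tensor_assoc f g h)
      rw [mk_comp, mk_comp, mk_ofEq, mk_ofEq] at this
      exact this)
    (leftUnitor_naturality := fun {X Y} f => by
      obtain ⟨f, rfl⟩ := exists_mk f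
      have h : (mk ((Term.id []).tensor f) : X ⟶ Y) = mk f := sound (Term.Rel.unit_tensor f)
      exact (Category.comp_id _).trans (h.trans (Category.id_comp _).symm))
    (rightUnitor_naturality := fun f => by
      obtain ⟨f, rfl⟩ := exists_mk f
      have := sound (Term.Rel.tensor_unit f)
      rw [mk_comp, mk_comp, mk_ofEq, mk_ofEq] at this
      exact this)
    (pentagon := fun W X Y Z => by
      simp only [associator_hom_eq, eqToHom_tensor_id, id_tensor_eqToHom]
      rw [eqToHom_trans, eqToHom_trans, eqToHom_trans])
    (triangle := fun X Y => by
      simp only [associator_hom_eq, leftUnitor_hom_eq, rightUnitor_hom_eq, eqToHom_tensor_id,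
        id_tensor_eqToHom]
      rw [eqToHom_trans])

/-- The symmetry, as an isomorphism. -/
def swapIso (X Y : Cau G) : X ⊗ Y ≅ Y ⊗ X where
  hom := mk (Term.swap X.word Y.word)
  inv := mk (Term.swap Y.word X.word)
  hom_inv_id := sound (Term.Rel.swap_swap _ _)
  inv_hom_id := sound (Term.Rel.swap_swap _ _)

theorem swapIso_hexagon (X Y Z : Cau G) :
    α_ X Y Z ≪≫ swapIso X (Y ⊗ Z) ≪≫ α_ Y Z X =
      whiskerRightIso (swapIso X Y) Z ≪≫ α_ Y X Z ≪≫ whiskerLeftIso Y (swapIso X Z) := by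
  have := sound (Term.Rel.hexagon (G := G) X.word Y.word Z.word)
  simp only [mk_comp, mk_ofEq] at this
  exact Iso.ext this

instance : SymmetricCategory (Cau G) where
  braiding := swapIso
  braiding_naturality_right X Y Z f := by
    obtain ⟨f, rfl⟩ := exists_mk f
    exact sound (Term.Rel.swap_natural (Term.id X.word) f)
  braiding_naturality_left f Z := by
    obtain ⟨f, rfl⟩ := exists_mk f
    exact sound (Term.Rel.swap_natural f (Term.id Z.word))
  hexagon_forward X Y Z := congrArg Iso.hom (swapIso_hexagon X Y Z)
  hexagon_reverse X Y Z := by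
    have := congrArg Iso.inv (swapIso_hexagon Z X Y)
    simp only [Iso.trans_inv, Category.assoc] at this
    exact this
  symmetry X Y := sound (Term.Rel.swap_swap _ _)

theorem braiding_hom_eq (X Y : Cau G) : (β_ X Y).hom = mk (Term.swap X.word Y.word) := rfl

instance (X : Cau G) : ComonObj X where
  comul := mk (Term.copy X.word)
  counit := mk (Term.discard X.word)
  counit_comul := by
    rw [← tensorHom_id]
    exact sound (Term.Rel.discard_copy X.word)
  comul_counit := by
    have := sound (Term.Rel.copy_discard (G := G) X.word)
    simp only [mk_comp, mk_ofEq] at this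
    rw [← id_tensorHom, ← cancel_mono (ρ_ X).hom, Iso.inv_hom_id, Category.assoc]
    exact this
  comul_assoc := by
    have := sound (Term.Rel.copy_assoc (G := G) X.word)
    simp only [mk_comp, mk_ofEq] at this
    rw [← id_tensorHom, ← tensorHom_id]
    exact this.symm

theorem comul_eq (X : Cau G) : Δ[X] = mk (Term.copy X.word) := rfl

theorem counit_eq (X : Cau G) : ε[X] = mk (Term.discard X.word) := rfl

instance (X : Cau G) : IsCommComonObj X where
  comul_comm := sound (Term.Rel.copy_swap X.word)

/-- The causal theory is a Markov category. -/
instance : MarkovCategory (Cau G) where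
  copy_tensor X Y := by
    have := sound (Term.Rel.copy_tensor (G := G) X.word Y.word)
    simp only [mk_comp, mk_tensor, mk_ofEq, mk_id] at this
    refine this.trans ?_
    simp only [tensorμ, associator_hom_eq, associator_inv_eq, whiskerLeft_eqToHom,
      eqToHom_trans_assoc, eqToHom_trans]
    rw [← id_tensorHom, ← tensorHom_id]
    rfl
  discard_tensor X Y :=
    (sound (Term.Rel.discard_tensor X.word Y.word)).trans (Category.comp_id _).symm
  copy_unit := sound Term.Rel.copy_unit
  discard_unit := sound Term.Rel.discard_unit
  discard_natural f := by
    obtain ⟨f, rfl⟩ := exists_mk f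
    exact sound (Term.Rel.discard_natural f)

/-- The causal mechanism `κ_a : pa a ⟶ a`. -/
def mech (G : CausalGraph V) (a : V) : (of (G.pa a) : Cau G) ⟶ of [a] :=
  mk (Term.mech a)

open scoped Classical in
/-- For a letter `b` occurring in the word `A`, the multiplier `A ⟶ b`: the identity on (the first
occurrence of) `b`, and discards on the other letters. -/
noncomputable def proj (G : CausalGraph V) (b : V) :
    (A : List V) → b ∈ A → ((of A : Cau G) ⟶ of [b])
  | [], h => absurd h List.not_mem_nil
  | a :: A, h =>
    if e : a = b then ((𝟙 (of [a]) ⊗ₘ ε[of A] : of (a :: A) ⟶ of [a])) ≫ eqToHom (by rw [e]; rfl)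
    else ((ε[of [a]] ⊗ₘ proj G b A ((List.mem_cons.1 h).resolve_left (Ne.symm e)) :
      of (a :: A) ⟶ of [b]))

/-- The multiplier `ι_{A → B}`, for a singular word `A` and a word `B` in letters of `A`: it is
composed of duplicates, discards and identities (on letters of `A`) only, and sends each letter of
`A` to its copies in `B`. -/
noncomputable def multiplier (G : CausalGraph V) (A : List V) :
    (B : List V) → B ⊆ A → ((of A : Cau G) ⟶ of B)
  | [], _ => ε[of A]
  | b :: B, h =>
    Δ[of A] ≫ (proj G b A (h List.mem_cons_self) ⊗ₘ
      multiplier G A B (List.subset_of_cons_subset h) : of A ⊗ of A ⟶ of (b :: B))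

end Cau

namespace CausalGraph

variable {V : Type u₀}

/-! ### Causal effects -/

/-- The vertices of the subgraph `G_{t → v}`: those of `t` and `v`, and those on directed paths
that end in `v` and do not pass through or end in `t` (starting in `t` is allowed). -/
def effectVertices (G : CausalGraph V) (t v : List V) : Set V :=
  {i | i ∈ t ∨ i ∈ v ∨ ∃ x q y, G.IsDirPath x q y ∧ y ∈ v ∧ (∀ z ∈ q, z ∉ t) ∧ i ∈ x :: q}

theorem IsDirPath.cons {G : CausalGraph V} {j x y : V} {q : List V} (h : G.IsDirPath x q y)
    (hj : G.Adj j x) : G.IsDirPath j (x :: q) y :=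
  ⟨List.cons_ne_nil _ _, List.isChain_cons_cons.2 ⟨hj, h.2.1⟩, by
    rw [List.getLast?_cons_cons]; exact h.2.2⟩

theorem effectVertices_parent {G : CausalGraph V} {t v : List V} {i j : V}
    (hi : i ∈ G.effectVertices t v) (hit : i ∉ t) (hj : j ∈ G.pa i) :
    j ∈ G.effectVertices t v := by
  have hadj := G.mem_pa.1 hj
  have key : i ∈ v → j ∈ G.effectVertices t v := fun hv =>
    Or.inr (Or.inr ⟨j, [i], i, ⟨by simp, by simpa using hadj, by simp⟩, hv, by simpa using hit,
      by simp⟩)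
  rcases hi with h | h | ⟨x, q, y, ⟨hne, hch, hl⟩, hy, hq, hmem⟩
  · exact absurd h hit
  · exact key h
  · obtain ⟨l₁, l₂, hs⟩ := List.append_of_mem hmem
    by_cases hl₂ : l₂ = []
    · subst hl₂
      rw [hs] at hl
      have : i = y := by simpa using hl
      exact key (this ▸ hy)
    · have hpath : G.IsDirPath i l₂ y := by
        refine ⟨hl₂, ?_, ?_⟩
        · rw [hs] at hch
          exact hch.suffix (List.suffix_append _ _)
        · rw [hs, List.getLast?_append] at hl
          cases h : (i :: l₂).getLast? with
          | none => simp at h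
          | some z => simpa [h] using hl
      refine Or.inr (Or.inr ⟨j, i :: l₂, y, hpath.cons hadj, hy, ?_, by simp⟩)
      intro z hz
      rcases List.mem_cons.1 hz with rfl | hz
      · exact hit
      · refine hq z ?_
        cases l₁ with
        | nil => simp at hs; exact hs.2 ▸ hz
        | cons a l₁ =>
          simp at hs
          rw [hs.2]
          simp [hz]

/-- There is a topological ordering of the vertices. -/
theorem exists_topologicalOrder [Finite V] (G : CausalGraph V) :
    ∃ L : List V, L.Nodup ∧ (∀ x, x ∈ L) ∧ L.Pairwise (fun a b => ¬ G.Adj b a) := by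
  classical
  have := Fintype.ofFinite V
  let r : V → ℕ := fun b => {a | Relation.TransGen G.Adj a b}.ncard
  have hr : ∀ a b, G.Adj a b → r a < r b := fun a b h => by
    refine Set.ncard_lt_ncard ⟨fun x hx => Relation.TransGen.tail hx h, fun hsub => ?_⟩
      (Set.toFinite _)
    exact G.acyclic a (hsub (Relation.TransGen.single h))
  refine ⟨(Finset.univ : Finset V).toList.mergeSort (fun a b => decide (r a ≤ r b)), ?_, ?_, ?_⟩
  · exact (List.mergeSort_perm _ _).nodup_iff.2 (Finset.nodup_toList _)
  · intro x
    exact (List.mergeSort_perm _ _).mem_iff.2 (by simp)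
  · refine (List.pairwise_mergeSort (le := fun a b => decide (r a ≤ r b)) ?_ ?_ _).imp ?_
    · intro a b c; simp only [decide_eq_true_eq]; omega
    · intro a b; simp only [Bool.or_eq_true, decide_eq_true_eq]; omega
    · intro a b h hadj
      have := hr _ _ hadj
      simp only [decide_eq_true_eq] at h
      omega

/-- A chosen topological ordering of the vertices: no vertex precedes one of its parents. -/
noncomputable def topologicalOrder [Finite V] (G : CausalGraph V) : List V :=
  Classical.choose G.exists_topologicalOrder

theorem topologicalOrder_spec [Finite V] (G : CausalGraph V) :
    G.topologicalOrder.Nodup ∧ (∀ x, x ∈ G.topologicalOrder) ∧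
      G.topologicalOrder.Pairwise (fun a b => ¬ G.Adj b a) :=
  Classical.choose_spec G.exists_topologicalOrder

/-- The vertices of `G_{t → v}` outside `t`, in topological order: those whose causal mechanisms
occur in the causal effect of `t` on `v`. -/
noncomputable def effectNodes [Finite V] (G : CausalGraph V) (t v : List V) : List V :=
  open scoped Classical in
  G.topologicalOrder.filter (fun i => decide (i ∈ G.effectVertices t v ∧ i ∉ t))

theorem mem_effectNodes [Finite V] {G : CausalGraph V} {t v : List V} {i : V} :
    i ∈ G.effectNodes t v ↔ i ∈ G.effectVertices t v ∧ i ∉ t := by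
  simp [effectNodes, (topologicalOrder_spec G).2.1 i]

/-- The mechanisms of the vertices in the list can be applied one after the other, starting from
the variables in `s`: the parents of each are among `s` and the vertices before it. -/
def Applicable (G : CausalGraph V) : List V → List V → Prop
  | _, [] => True
  | s, i :: L => G.pa i ⊆ s ∧ Applicable G (i :: s) L

theorem applicable_of_pairwise {G : CausalGraph V} :
    ∀ (L s : List V), L.Pairwise (fun a b => ¬ G.Adj b a) →
      (∀ i ∈ L, ∀ j ∈ G.pa i, j ∈ s ∨ j ∈ L) → G.Applicable s L
  | [], _, _, _ => trivial
  | i :: L, s, hp, h => by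
    rw [List.pairwise_cons] at hp
    refine ⟨fun j hj => ?_, applicable_of_pairwise L (i :: s) hp.2 fun k hk j hj => ?_⟩
    · rcases h i List.mem_cons_self j hj with hs | hs
      · exact hs
      · have hadj := G.mem_pa.1 hj
        rcases List.mem_cons.1 hs with rfl | hL
        · exact absurd (Relation.TransGen.single hadj) (G.acyclic _)
        · exact absurd hadj (hp.1 j hL)
    · rcases h k (List.mem_cons_of_mem _ hk) j hj with hs | hs
      · exact Or.inl (List.mem_cons_of_mem _ hs)
      · rcases List.mem_cons.1 hs with rfl | hL
        · exact Or.inl List.mem_cons_self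
        · exact Or.inr hL

theorem applicable_effectNodes [Finite V] (G : CausalGraph V) (t v : List V) :
    G.Applicable t (G.effectNodes t v) := by
  refine applicable_of_pairwise _ _ ((topologicalOrder_spec G).2.2.filter _) fun i hi j hj => ?_
  rw [mem_effectNodes] at hi
  by_cases hjt : j ∈ t
  · exact Or.inl hjt
  · exact Or.inr (mem_effectNodes.2 ⟨effectVertices_parent hi.1 hi.2 hj, hjt⟩)

theorem subset_effectNodes [Finite V] (G : CausalGraph V) (t v : List V) :
    v ⊆ (G.effectNodes t v).reverse ++ t := fun i hi => by
  rw [List.mem_append, List.mem_reverse, mem_effectNodes]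
  by_cases hit : i ∈ t
  · exact Or.inr hit
  · exact Or.inl ⟨Or.inr (Or.inl hi), hit⟩

/-- Starting from one wire for each variable in `s`, apply the mechanisms of the listed vertices
one after the other, each to fresh copies of the wires of its parents, and keep one wire for every
variable. -/
noncomputable def applyMechs (G : CausalGraph V) :
    (L s : List V) → G.Applicable s L → ((Cau.of s : Cau G) ⟶ Cau.of (L.reverse ++ s))
  | [], s, _ => 𝟙 (Cau.of s)
  | i :: L, s, h =>
    (Cau.multiplier G s (G.pa i ++ s) (List.append_subset.2 ⟨h.1, List.Subset.refl s⟩) ≫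
      (Cau.mech G i ⊗ₘ 𝟙 (Cau.of s) : Cau.of (G.pa i) ⊗ Cau.of s ⟶ Cau.of (i :: s))) ≫
    applyMechs G L (i :: s) h.2 ≫ eqToHom (by simp)

/-- The causal effect `[v ‖ t] : t ⟶ v`, the morphism represented by the following string diagram.
Its input wires are `t`, and its nodes are the mechanisms `κ_i` of the vertices `i ∉ t` of
`G_{t → v}`. The wire of each vertex of `G_{t → v}` (the output of `κ_i`, or an input wire) is
copied by multipliers to all its children in `G_{t → v}` and, if it is in `v`, to the output.

The diagram is written out as a composite along a topological ordering of the nodes; surplus copies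
are discarded by the last multiplier, and by coassociativity, counitality, cocommutativity and the
axioms of symmetric monoidal categories the morphism does not depend on the ordering. -/
noncomputable def effect [Finite V] (G : CausalGraph V) (v t : List V) :
    (Cau.of t : Cau G) ⟶ Cau.of v :=
  G.applyMechs (G.effectNodes t v) t (G.applicable_effectNodes t v) ≫
    Cau.multiplier G ((G.effectNodes t v).reverse ++ t) v (G.subset_effectNodes t v)

/-- `[vw ‖ u]` is decomposable over `v`: copy `u`, apply `[v ‖ u]` to the first copy, copy the
result `v`, and feed the second copies of `v` and `u` into `[w ‖ vu]`. -/
def Decomposable [Finite V] (G : CausalGraph V) (u v w : List V) : Prop :=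
  (G.effect (v ++ w) u : (Cau.of u : Cau G) ⟶ Cau.of v ⊗ Cau.of w) =
    Δ[Cau.of u] ≫ (G.effect v u ▷ Cau.of u) ≫ (Δ[Cau.of v] ▷ Cau.of u) ≫
      (α_ (Cau.of v) (Cau.of v) (Cau.of u)).hom ≫
      (Cau.of v ◁ (G.effect w (v ++ u) : Cau.of v ⊗ Cau.of u ⟶ Cau.of w))

end CausalGraph

namespace CategoryTheory.MarkovCategory

universe v₁ u₁

variable {C : Type u₁} [Category.{v₁} C] [MonoidalCategory.{v₁} C] [MarkovCategory C]

/-- The joint morphism `X ⟶ A ⊗ B` of two morphisms out of `X`: copy, then apply both. -/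
def pair {X A B : C} (f : X ⟶ A) (g : X ⟶ B) : X ⟶ A ⊗ B :=
  Δ[X] ≫ (f ⊗ₘ g)

/-- Discard the second factor. -/
def fst (X Y : C) : X ⊗ Y ⟶ X :=
  (𝟙 X ⊗ₘ ε[Y]) ≫ (ρ_ X).hom

/-- Discard the first factor. -/
def snd (X Y : C) : X ⊗ Y ⟶ Y :=
  (ε[X] ⊗ₘ 𝟙 Y) ≫ (λ_ Y).hom

variable {W X Y Z A B D A' B' : C}

theorem pair_tensorHom (f : X ⟶ A) (g : X ⟶ B) (a : A ⟶ A') (b : B ⟶ B') :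
    pair f g ≫ (a ⊗ₘ b) = pair (f ≫ a) (g ≫ b) := by
  simp [pair]

theorem pair_tensorHom_assoc (f : X ⟶ A) (g : X ⟶ B) (a : A ⟶ A') (b : B ⟶ B')
    (k : A' ⊗ B' ⟶ Z) : pair f g ≫ (a ⊗ₘ b) ≫ k = pair (f ≫ a) (g ≫ b) ≫ k := by
  rw [← Category.assoc, pair_tensorHom]

theorem pair_whiskerLeft (f : X ⟶ A) (g : X ⟶ B) (b : B ⟶ B') :
    pair f g ≫ (A ◁ b) = pair f (g ≫ b) := by
  rw [← id_tensorHom, pair_tensorHom, Category.comp_id]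

theorem pair_whiskerLeft_assoc (f : X ⟶ A) (g : X ⟶ B) (b : B ⟶ B')
    (k : A ⊗ B' ⟶ Z) : pair f g ≫ (A ◁ b) ≫ k = pair f (g ≫ b) ≫ k := by
  rw [← Category.assoc, pair_whiskerLeft]

theorem pair_whiskerRight (f : X ⟶ A) (g : X ⟶ B) (a : A ⟶ A') :
    pair f g ≫ (a ▷ B) = pair (f ≫ a) g := by
  rw [← tensorHom_id, pair_tensorHom, Category.comp_id]

theorem pair_whiskerRight_assoc (f : X ⟶ A) (g : X ⟶ B) (a : A ⟶ A')
    (k : A' ⊗ B ⟶ Z) : pair f g ≫ (a ▷ B) ≫ k = pair (f ≫ a) g ≫ k := by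
  rw [← Category.assoc, pair_whiskerRight]

/-- The morphisms that commute with copying. -/
class Copyable (f : X ⟶ Y) : Prop where
  comp_comul : f ≫ Δ[Y] = pair f f

theorem comp_pair (h : W ⟶ X) [Copyable h] (f : X ⟶ A) (g : X ⟶ B) :
    h ≫ pair f g = pair (h ≫ f) (h ≫ g) := by
  rw [pair, ← Category.assoc, Copyable.comp_comul, pair_tensorHom]

theorem pair_id_id (X : C) : pair (𝟙 X) (𝟙 X) = Δ[X] := by
  simp [pair]

theorem pair_braiding (f : X ⟶ A) (g : X ⟶ B) : pair f g ≫ (β_ A B).hom = pair g f := by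
  simp [pair]

theorem pair_braiding_assoc (f : X ⟶ A) (g : X ⟶ B)
    (k : B ⊗ A ⟶ Z) : pair f g ≫ (β_ A B).hom ≫ k = pair g f ≫ k := by
  rw [← Category.assoc, pair_braiding]

theorem pair_associator (f : X ⟶ A) (g : X ⟶ B) (h : X ⟶ D) :
    pair (pair f g) h ≫ (α_ A B D).hom = pair f (pair g h) := by
  have h1 : pair (pair f g) h = Δ[X] ≫ (Δ[X] ▷ X) ≫ ((f ⊗ₘ g) ⊗ₘ h) := by
    simp only [pair, ← tensorHom_id, tensorHom_comp_tensorHom, Category.id_comp]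
  have h2 : pair f (pair g h) = Δ[X] ≫ (X ◁ Δ[X]) ≫ (f ⊗ₘ (g ⊗ₘ h)) := by
    simp only [pair, ← id_tensorHom, tensorHom_comp_tensorHom, Category.id_comp]
  rw [h1, h2, Category.assoc, Category.assoc, associator_naturality, comul_assoc_assoc]

theorem pair_associator_assoc (f : X ⟶ A) (g : X ⟶ B) (h : X ⟶ D)
    (k : A ⊗ B ⊗ D ⟶ Z) : pair (pair f g) h ≫ (α_ A B D).hom ≫ k = pair f (pair g h) ≫ k := by
  rw [← Category.assoc, pair_associator]

theorem pair_associator_inv (f : X ⟶ A) (g : X ⟶ B) (h : X ⟶ D) :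
    pair f (pair g h) ≫ (α_ A B D).inv = pair (pair f g) h := by
  rw [← pair_associator, Category.assoc, Iso.hom_inv_id, Category.comp_id]

theorem pair_associator_inv_assoc (f : X ⟶ A) (g : X ⟶ B) (h : X ⟶ D)
    (k : (A ⊗ B) ⊗ D ⟶ Z) : pair f (pair g h) ≫ (α_ A B D).inv ≫ k = pair (pair f g) h ≫ k := by
  rw [← Category.assoc, pair_associator_inv]

theorem pair_tensorμ (f : X ⟶ A) (g : X ⟶ B) (h : X ⟶ A') (k : X ⟶ B') :
    pair (pair f g) (pair h k) ≫ tensorμ A B A' B' = pair (pair f h) (pair g k) := by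
  simp only [tensorμ, pair_associator_assoc, pair_whiskerLeft_assoc,
    pair_associator_inv, pair_whiskerRight, pair_braiding, pair_associator]

theorem pair_counit_left (f : X ⟶ A) : pair ε[X] f ≫ (λ_ A).hom = f := by
  have : pair ε[X] f = Δ[X] ≫ (ε[X] ▷ X) ≫ (𝟙_ C ◁ f) := by
    simp [pair]
  simp [this]

theorem pair_snd (f : X ⟶ A) (g : X ⟶ B) : pair f g ≫ snd A B = g := by
  rw [snd, pair_tensorHom_assoc, discard_natural, Category.comp_id, pair_counit_left]

theorem braiding_snd : (β_ A B).hom ≫ snd B A = fst A B := by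
  rw [fst, snd, id_tensorHom, tensorHom_id, ← BraidedCategory.braiding_naturality_right_assoc,
    braiding_leftUnitor]

theorem pair_fst (f : X ⟶ A) (g : X ⟶ B) : pair f g ≫ fst A B = f := by
  rw [← braiding_snd, pair_braiding_assoc, pair_snd]

theorem pair_fst_snd (A B : C) : pair (fst A B) (snd A B) = 𝟙 (A ⊗ B) := by
  have h : tensorμ A (𝟙_ C) (𝟙_ C) B = 𝟙 _ := by
    have hb : (β_ (𝟙_ C) (𝟙_ C)).hom = 𝟙 _ := by
      rw [braiding_tensorUnit_left, unitors_equal, Iso.hom_inv_id]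
    simp [tensorμ, hb]
  have h1 : Δ[B] ≫ (ε[B] ⊗ₘ 𝟙 B) ≫ (λ_ B).hom = 𝟙 B := pair_snd (𝟙 B) (𝟙 B) |> fun e => by
    rwa [pair, id_tensorHom_id, Category.comp_id, snd] at e
  have h2 : Δ[A] ≫ (𝟙 A ⊗ₘ ε[A]) ≫ (ρ_ A).hom = 𝟙 A := pair_fst (𝟙 A) (𝟙 A) |> fun e => by
    rwa [pair, id_tensorHom_id, Category.comp_id, fst] at e
  rw [pair, CopyDiscardCategory.copy_tensor, fst, snd, ← tensorHom_comp_tensorHom, Category.assoc,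
    ← tensorμ_natural_assoc, h, Category.id_comp, tensorHom_comp_tensorHom,
    tensorHom_comp_tensorHom, h1, h2, id_tensorHom_id]

instance copyable_id (X : C) : Copyable (𝟙 X) :=
  ⟨by rw [Category.id_comp, pair_id_id]⟩

instance copyable_comp (f : X ⟶ Y) (g : Y ⟶ Z) [Copyable f] [Copyable g] : Copyable (f ≫ g) :=
  ⟨by rw [Category.assoc, Copyable.comp_comul, comp_pair]⟩

instance copyable_counit (X : C) : Copyable ε[X] :=
  ⟨by
    rw [CopyDiscardCategory.copy_unit, Iso.comp_inv_eq, pair_counit_left]⟩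

instance copyable_pair (f : X ⟶ A) (g : X ⟶ B) [Copyable f] [Copyable g] :
    Copyable (pair f g) :=
  ⟨by
    rw [CopyDiscardCategory.copy_tensor, pair_tensorHom_assoc, Copyable.comp_comul,
      Copyable.comp_comul, pair_tensorμ]⟩

instance copyable_tensorHom (f : X ⟶ A) (g : Y ⟶ B) [Copyable f] [Copyable g] :
    Copyable (f ⊗ₘ g) :=
  ⟨by
    rw [pair, CopyDiscardCategory.copy_tensor, CopyDiscardCategory.copy_tensor, Category.assoc,
      ← tensorμ_natural, tensorHom_comp_tensorHom_assoc, tensorHom_comp_tensorHom_assoc,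
      Copyable.comp_comul, Copyable.comp_comul, pair, pair]⟩

instance copyable_leftUnitor_hom (X : C) : Copyable (λ_ X).hom :=
  ⟨by
    rw [pair, CopyDiscardCategory.copy_tensor, CopyDiscardCategory.copy_unit,
      ← leftUnitor_naturality, tensor_left_unitality, Category.assoc,
      tensorHom_def' (λ_ (𝟙_ C)).inv Δ[X],
      Category.assoc]⟩

instance copyable_snd (X Y : C) : Copyable (snd X Y) := by
  unfold snd; infer_instance

/-- The symmetry that moves the second of three factors to the front. -/
def leftComm (A B D : C) : A ⊗ (B ⊗ D) ⟶ B ⊗ (A ⊗ D) :=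
  (α_ A B D).inv ≫ (β_ A B).hom ▷ D ≫ (α_ B A D).hom

theorem pair_leftComm (f : X ⟶ A) (g : X ⟶ B) (h : X ⟶ D) :
    pair f (pair g h) ≫ leftComm A B D = pair g (pair f h) := by
  rw [leftComm, pair_associator_inv_assoc, pair_whiskerRight_assoc, pair_braiding,
    pair_associator]

/-- Extending the state `X` by `k` and then by a morphism that does not use the result of `k` is
the same as extending it by both at once. -/
theorem pair_comp_pair_snd (k : X ⟶ A) (m : X ⟶ B) :
    pair k (𝟙 X) ≫ pair (snd A X ≫ m) (𝟙 (A ⊗ X)) = pair m (pair k (𝟙 X)) := by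
  have h : pair (snd A X ≫ m) (𝟙 (A ⊗ X)) = (A ◁ pair m (𝟙 X)) ≫ leftComm A B X := by
    rw [← pair_fst_snd, ← pair_leftComm]
    congr 1
    have := comp_pair (snd A X) m (𝟙 X)
    rw [Category.comp_id] at this
    rw [← this, ← pair_whiskerLeft, pair_fst_snd, Category.id_comp]
  rw [h, pair_whiskerLeft_assoc, Category.id_comp, pair_leftComm]

end CategoryTheory.MarkovCategory

namespace Cau

open CausalGraph MarkovCategory

variable {V : Type u₀} {G : CausalGraph V} {X Y : Cau G} {A A' B B' D : List V} {a b : V}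

/-! ### Joint morphisms between words -/

/-- The joint morphism of two morphisms with the same source, between words. -/
def joint (f : X ⟶ of A) (g : X ⟶ of B) : X ⟶ of (A ++ B) := pair f g

/-- The joint morphism of two morphisms, of which the first has a letter as target. -/
def cons (f : X ⟶ of [b]) (g : X ⟶ of B) : X ⟶ of (b :: B) := pair f g

/-- The monoidal product of the identity of a letter with a morphism. -/
def consMap (b : V) (g : (of B : Cau G) ⟶ of B') : (of (b :: B) : Cau G) ⟶ of (b :: B') :=
  𝟙 (of [b]) ⊗ₘ g

/-- Discard all letters but the first. -/
def head (G : CausalGraph V) (b : V) (B : List V) : (of (b :: B) : Cau G) ⟶ of [b] :=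
  fst (of [b]) (of B)

/-- Discard the first letter. -/
def tail (G : CausalGraph V) (b : V) (B : List V) : (of (b :: B) : Cau G) ⟶ of B :=
  snd (of [b]) (of B)

theorem cons_eq_joint (f : X ⟶ of [b]) (g : X ⟶ of B) : cons f g = joint f g := rfl

theorem comp_cons (h : Y ⟶ X) [Copyable h] (f : X ⟶ of [b]) (g : X ⟶ of B) :
    h ≫ cons f g = cons (h ≫ f) (h ≫ g) :=
  comp_pair h f g

theorem cons_consMap (f : X ⟶ of [b]) (g : X ⟶ of B) (h : (of B : Cau G) ⟶ of B') :
    cons f g ≫ consMap b h = cons f (g ≫ h) :=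
  (pair_tensorHom f g (𝟙 _) h).trans (by rw [Category.comp_id]; rfl)

theorem cons_head (f : X ⟶ of [b]) (g : X ⟶ of B) : cons f g ≫ head G b B = f :=
  pair_fst f g

theorem cons_tail (f : X ⟶ of [b]) (g : X ⟶ of B) : cons f g ≫ tail G b B = g :=
  pair_snd f g

theorem cons_tail_assoc {Z : Cau G} (f : X ⟶ of [b]) (g : X ⟶ of B)
    (k : of B ⟶ Z) : cons f g ≫ tail G b B ≫ k = g ≫ k := by
  rw [← Category.assoc, cons_tail]

theorem cons_head_tail (b : V) (B : List V) : cons (head G b B) (tail G b B) = 𝟙 _ :=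
  pair_fst_snd _ _

theorem joint_counit (f : X ⟶ of B) (e : X ⟶ of []) : joint e f = f := by
  have he : e = ε[X] := eq_discard X e
  rw [he]
  exact (Category.comp_id _).symm.trans (pair_counit_left f)

theorem cons_joint (f : X ⟶ of [b]) (g : X ⟶ of A) (h : X ⟶ of B) :
    joint (cons f g) h = cons f (joint g h) :=
  (Category.comp_id _).symm.trans (pair_associator f g h)

instance copyable_eqToHom {X Y : Cau G} (h : X = Y) : Copyable (eqToHom h) := by
  subst h; exact copyable_id X

instance copyable_head (b : V) (B : List V) : Copyable (head G b B) := by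
  have h : Copyable ((𝟙 (of [b] : Cau G)) ⊗ₘ ε[(of B : Cau G)]) := inferInstance
  exact copyable_comp _ (eqToHom rfl)

instance copyable_tail (b : V) (B : List V) : Copyable (tail G b B) :=
  copyable_snd (of [b] : Cau G) (of B)

instance copyable_cons (f : X ⟶ of [b]) (g : X ⟶ of B) [Copyable f] [Copyable g] :
    Copyable (cons f g) :=
  copyable_pair f g

/-! ### Multipliers -/

theorem proj_cons_self (b : V) (A : List V) (h : b ∈ b :: A) : proj G b (b :: A) h = head G b A := by
  rw [proj, dif_pos rfl]
  rfl

theorem proj_cons_of_ne (h : b ∈ a :: A) (hab : a ≠ b) (h' : b ∈ A) :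
    proj G b (a :: A) h = tail G a A ≫ proj G b A h' := by
  have h1 : (ε[(of [a] : Cau G)] ⊗ₘ proj G b A h') ≫ (λ_ (of [b])).hom =
      snd (of [a]) (of A) ≫ proj G b A h' := by
    rw [snd, Category.assoc, ← leftUnitor_naturality, ← id_tensorHom,
      tensorHom_comp_tensorHom_assoc, Category.comp_id, Category.id_comp]
  rw [proj, dif_neg hab]
  exact (Category.comp_id _).symm.trans h1

instance copyable_proj (b : V) : ∀ (A : List V) (h : b ∈ A), Copyable (proj G b A h)
  | [], h => absurd h List.not_mem_nil
  | a :: A, h => by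
    by_cases hab : a = b
    · subst hab
      rw [proj_cons_self]
      infer_instance
    · have h' := (List.mem_cons.1 h).resolve_left (Ne.symm hab)
      have := copyable_proj b A h'
      rw [proj_cons_of_ne h hab h']
      infer_instance

theorem multiplier_cons (A : List V) (h : b :: B ⊆ A) :
    multiplier G A (b :: B) h =
      cons (proj G b A (h List.mem_cons_self))
        (multiplier G A B (List.subset_of_cons_subset h)) :=
  rfl

instance copyable_multiplier (A : List V) :
    ∀ (B : List V) (h : B ⊆ A), Copyable (multiplier G A B h)
  | [], _ => copyable_counit (of A : Cau G)
  | b :: B, h => by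
    have := copyable_multiplier A B (List.subset_of_cons_subset h)
    rw [multiplier_cons]
    infer_instance

theorem multiplier_append (A : List V) :
    ∀ (B D : List V) (h : B ++ D ⊆ A), multiplier G A (B ++ D) h =
      joint (multiplier G A B (List.append_subset.1 h).1)
        (multiplier G A D (List.append_subset.1 h).2)
  | [], D, h => (joint_counit _ _).symm
  | b :: B, D, h => by
    rw [multiplier_cons, cons_joint, ← multiplier_append A B D (List.subset_of_cons_subset h)]
    rfl

theorem multiplier_comp_proj (A : List V) :
    ∀ (B : List V) (h : B ⊆ A) (hb : b ∈ B),
      multiplier G A B h ≫ proj G b B hb = proj G b A (h hb)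
  | [], _, hb => absurd hb List.not_mem_nil
  | a :: B, h, hb => by
    rw [multiplier_cons]
    by_cases hab : a = b
    · subst hab
      rw [proj_cons_self, cons_head]
    · have h' := (List.mem_cons.1 hb).resolve_left (Ne.symm hab)
      rw [proj_cons_of_ne hb hab h', cons_tail_assoc, multiplier_comp_proj A B _ h']

theorem multiplier_comp (A B : List V) (h : B ⊆ A) :
    ∀ (D : List V) (hD : D ⊆ B),
      multiplier G A B h ≫ multiplier G B D hD = multiplier G A D (List.Subset.trans hD h)
  | [], _ => discard_natural (multiplier G A B h)
  | b :: D, hD => by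
    rw [multiplier_cons, comp_cons, multiplier_comp_proj, multiplier_comp A B h D]
    rfl

theorem multiplier_comp_assoc {Z : Cau G} (A B D : List V) (h : B ⊆ A) (hD : D ⊆ B)
    (k : of D ⟶ Z) :
    multiplier G A B h ≫ multiplier G B D hD ≫ k =
      multiplier G A D (List.Subset.trans hD h) ≫ k := by
  rw [← Category.assoc, multiplier_comp]

theorem multiplier_cons_left (a : V) (A : List V) :
    ∀ (B : List V) (h : B ⊆ a :: A) (h' : B ⊆ A), a ∉ B →
      multiplier G (a :: A) B h = tail G a A ≫ multiplier G A B h'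
  | [], _, _, _ => (discard_natural (tail G a A)).symm
  | b :: B, h, h', ha => by
    rw [multiplier_cons, multiplier_cons, comp_cons,
      ← multiplier_cons_left a A B (List.subset_of_cons_subset h)
        (List.subset_of_cons_subset h') (fun hB => ha (List.mem_cons_of_mem _ hB)),
      proj_cons_of_ne _ (fun e => ha (List.mem_cons.2 (Or.inl e))) (h' List.mem_cons_self)]

theorem multiplier_consMap (a : V) (A B : List V) (h : a :: B ⊆ a :: A) (h' : B ⊆ A)
    (ha : a ∉ B) : multiplier G (a :: A) (a :: B) h = consMap a (multiplier G A B h') := by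
  rw [multiplier_cons, proj_cons_self, multiplier_cons_left a A B _ h' ha, ← cons_consMap,
    cons_head_tail, Category.id_comp]

theorem multiplier_self : ∀ (A : List V) (h : A ⊆ A), A.Nodup → multiplier G A A h = 𝟙 _
  | [], _, _ => CopyDiscardCategory.discard_unit (C := Cau G)
  | a :: A, h, hA => by
    rw [multiplier_consMap a A A h (List.Subset.refl A) (List.nodup_cons.1 hA).1,
      multiplier_self A _ (List.nodup_cons.1 hA).2]
    exact id_tensorHom_id _ _

theorem eqToHom_comp_multiplier (h : A = A') (hX : (of A : Cau G) = of A') (hB : B ⊆ A') :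
    eqToHom hX ≫ multiplier G A' B hB = multiplier G A B (h ▸ hB) := by
  subst h
  exact Category.id_comp _

end Cau

namespace Cau

open CausalGraph MarkovCategory

variable {V : Type u₀} {G : CausalGraph V} {X : Cau G} {A B B' : List V}

/-- The monoidal product of the identity of a word with a morphism. -/
def appendMap (A : List V) (g : (of B : Cau G) ⟶ of B') :
    (of (A ++ B) : Cau G) ⟶ of (A ++ B') :=
  of A ◁ g

theorem joint_appendMap (f : X ⟶ of A) (g : X ⟶ of B) (h : (of B : Cau G) ⟶ of B') :
    joint f g ≫ appendMap A h = joint f (g ≫ h) :=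
  pair_whiskerLeft f g h

/-- The symmetry of two words. -/
def swap (G : CausalGraph V) (A B : List V) : (of (A ++ B) : Cau G) ⟶ of (B ++ A) :=
  (β_ (of A) (of B)).hom

theorem joint_swap (f : X ⟶ of A) (g : X ⟶ of B) : joint f g ≫ swap G A B = joint g f :=
  pair_braiding f g

theorem swap_eq_multiplier (hAB : (A ++ B).Nodup) (h : B ++ A ⊆ A ++ B) :
    swap G A B = multiplier G (A ++ B) (B ++ A) h := by
  rw [multiplier_append, ← joint_swap, ← multiplier_append _ _ _ (List.Subset.refl _),
    multiplier_self _ _ hAB, Category.id_comp]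

/-! ### Applying mechanisms one after the other -/

/-- Apply the mechanism of `i` to copies of the wires of its parents. -/
noncomputable def step (i : V) (s : List V) (h : G.pa i ⊆ s) :
    (of s : Cau G) ⟶ of (i :: s) :=
  cons (multiplier G s (G.pa i) h ≫ mech G i) (𝟙 (of s))

theorem multiplier_comp_mech (i : V) (s : List V) (hs : s.Nodup) (h : G.pa i ++ s ⊆ s) :
    (multiplier G s (G.pa i ++ s) h ≫
      (mech G i ⊗ₘ 𝟙 (of s) : of (G.pa i) ⊗ of s ⟶ of (i :: s))) =
      step i s (List.append_subset.1 h).1 := by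
  rw [multiplier_append, multiplier_self s _ hs]
  exact (pair_tensorHom _ _ _ _).trans (by rw [Category.comp_id]; rfl)

theorem multiplier_comp_step (i : V) (s s' : List V) (hs : s' ⊆ s) (h : G.pa i ⊆ s')
    (hi : i ∉ s') (h' : i :: s' ⊆ i :: s) :
    multiplier G s s' hs ≫ step i s' h =
      step i s (List.Subset.trans h hs) ≫ multiplier G (i :: s) (i :: s') h' := by
  rw [multiplier_consMap i s s' h' hs hi, step, step, cons_consMap, comp_cons,
    multiplier_comp_assoc, Category.comp_id, Category.id_comp]

theorem joint_step (i : V) (s : List V) (h : G.pa i ⊆ s) (m : (of s : Cau G) ⟶ of A) :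
    joint m (step i s h) = step i s h ≫ joint (tail G i s ≫ m) (𝟙 _) :=
  (pair_comp_pair_snd _ m).symm

/-- The exchange of the first two letters of a word. -/
def exchange (G : CausalGraph V) (i j : V) (s : List V) :
    (of (j :: i :: s) : Cau G) ⟶ of (i :: j :: s) :=
  leftComm (of [j]) (of [i]) (of s)

theorem cons_exchange {i j : V} {s : List V} (f : X ⟶ of [j]) (g : X ⟶ of [i]) (h : X ⟶ of s) :
    cons f (cons g h) ≫ exchange G i j s = cons g (cons f h) :=
  pair_leftComm f g h

theorem exchange_eq_multiplier (i j : V) (s : List V) (hs : (i :: j :: s).Nodup)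
    (h : i :: j :: s ⊆ j :: i :: s) :
    exchange G i j s = multiplier G (j :: i :: s) (i :: j :: s) h := by
  have hij : j ≠ i := fun e => (List.nodup_cons.1 hs).1 (List.mem_cons.2 (Or.inl e.symm))
  have hi : i ∉ s := fun e => (List.nodup_cons.1 hs).1 (List.mem_cons_of_mem _ e)
  have hs' := List.nodup_cons.1 (List.nodup_cons.1 hs).2
  have hid : 𝟙 (of (j :: i :: s) : Cau G) =
      cons (head G j (i :: s)) (cons (tail G j (i :: s) ≫ head G i s)
        (tail G j (i :: s) ≫ tail G i s)) := by
    rw [← comp_cons, cons_head_tail, Category.comp_id, cons_head_tail]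
  rw [← Category.id_comp (exchange G i j s), hid, cons_exchange, multiplier_cons, multiplier_cons,
    proj_cons_self, proj_cons_of_ne _ hij List.mem_cons_self, proj_cons_self,
    multiplier_cons_left j (i :: s) s _ (List.subset_cons_self i s) hs'.1,
    multiplier_cons_left i s s _ (List.Subset.refl s) hi, multiplier_self s _ hs'.2,
    Category.comp_id]

theorem step_cons_eq (i j : V) (s : List V) (hj : G.pa j ⊆ s) (hi : i ∉ s)
    (hj' : G.pa j ⊆ i :: s) :
    step j (i :: s) hj' =
      joint (tail G i s ≫ multiplier G s (G.pa j) hj ≫ mech G j) (𝟙 (of (i :: s))) := by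
  rw [step, multiplier_cons_left i s (G.pa j) hj' hj (fun h => hi (hj h)), cons_eq_joint,
    Category.assoc]

theorem step_step (i j : V) (s : List V) (hi : G.pa i ⊆ s) (hj : G.pa j ⊆ s)
    (hs : (i :: j :: s).Nodup) (hi' : G.pa i ⊆ j :: s) (hj' : G.pa j ⊆ i :: s)
    (h : i :: j :: s ⊆ j :: i :: s) :
    step i s hi ≫ step j (i :: s) hj' ≫ multiplier G (j :: i :: s) (i :: j :: s) h =
      step j s hj ≫ step i (j :: s) hi' := by
  have hin : i ∉ s := fun e => (List.nodup_cons.1 hs).1 (List.mem_cons_of_mem _ e)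
  have hjn : j ∉ s := (List.nodup_cons.1 (List.nodup_cons.1 hs).2).1
  rw [← exchange_eq_multiplier i j s hs, step_cons_eq i j s hj hin, step_cons_eq j i s hi hjn,
    ← joint_step j, ← Category.assoc, ← joint_step i]
  exact cons_exchange _ _ _

end Cau

namespace CausalGraph

open Cau MarkovCategory

variable {V : Type u₀} {G : CausalGraph V}

theorem Applicable.pa_subset {i : V} {L s : List V} (h : G.Applicable s (i :: L)) :
    G.pa i ⊆ s :=
  h.1

theorem Applicable.of_cons {i : V} {L s : List V} (h : G.Applicable s (i :: L)) :
    G.Applicable (i :: s) L :=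
  h.2

theorem Applicable.mono : ∀ {L s s' : List V}, G.Applicable s' L → s' ⊆ s → G.Applicable s L
  | [], _, _, _, _ => trivial
  | i :: _, _, _, h, hs =>
    ⟨List.Subset.trans h.1 hs, h.2.mono (List.cons_subset_cons i hs)⟩

theorem Applicable.erase_middle {L₂ : List V} {j : V} :
    ∀ {L₁ s : List V}, G.Applicable s (L₁ ++ j :: L₂) → G.Applicable (j :: s) (L₁ ++ L₂)
  | [], _, h => h.2
  | i :: L₁, s, h => by
    refine ⟨List.subset_cons_of_subset j h.1, ?_⟩
    exact (Applicable.erase_middle (L₁ := L₁) h.2).mono (List.Perm.swap i j s).subset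

/-- Starting from the variables in `s`, apply the mechanisms in `L` one after the other and return
copies of the variables in `T`. -/
noncomputable def flow (L s T : List V) (h : G.Applicable s L) (hT : T ⊆ L.reverse ++ s) :
    (of s : Cau G) ⟶ of T :=
  G.applyMechs L s h ≫ multiplier G (L.reverse ++ s) T hT

theorem flow_nil (s T : List V) (h : G.Applicable s []) (hT : T ⊆ [].reverse ++ s) :
    flow [] s T h hT = multiplier G s T hT :=
  Category.id_comp _

theorem flow_cons (i : V) (L s T : List V) (hs : s.Nodup) (h : G.Applicable s (i :: L))
    (hT : T ⊆ (i :: L).reverse ++ s) :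
    flow (i :: L) s T h hT = step i s h.pa_subset ≫ flow L (i :: s) T h.of_cons (by simpa using hT) := by
  rw [flow, applyMechs, multiplier_comp_mech i s hs, Category.assoc, Category.assoc,
    eqToHom_comp_multiplier (by simp), flow]

theorem flow_comp_multiplier (L s T T' : List V) (h : G.Applicable s L)
    (hT : T ⊆ L.reverse ++ s) (hT' : T' ⊆ T) :
    flow L s T h hT ≫ multiplier G T T' hT' = flow L s T' h (List.Subset.trans hT' hT) := by
  rw [flow, Category.assoc, multiplier_comp, flow]

theorem multiplier_comp_flow : ∀ (L s s' T : List V) (hs : s' ⊆ s) (h' : G.Applicable s' L)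
    (h : G.Applicable s L) (hT' : T ⊆ L.reverse ++ s') (hT : T ⊆ L.reverse ++ s)
    (_ : (L ++ s).Nodup) (_ : (L ++ s').Nodup),
    multiplier G s s' hs ≫ flow L s' T h' hT' = flow L s T h hT
  | [], s, s', T, hs, h', h, hT', hT, _, _ => by
    rw [flow_nil s', flow_nil s]
    exact multiplier_comp s s' hs T hT'
  | i :: L, s, s', T, hs, h', h, hT', hT, hL, hL' => by
    have hL₁ : (L ++ i :: s).Nodup := by
      rwa [List.nodup_middle]
    have hL₁' : (L ++ i :: s').Nodup := by
      rwa [List.nodup_middle]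
    have hi' : i ∉ s' := fun hi => (List.nodup_cons.1 hL').1 (List.mem_append_right _ hi)
    rw [flow_cons i L s' T (List.Nodup.of_append_right hL'),
      flow_cons i L s T (List.Nodup.of_append_right hL),
      ← Category.assoc, multiplier_comp_step i s s' hs _ hi' (List.cons_subset_cons i hs),
      Category.assoc, multiplier_comp_flow L (i :: s) (i :: s') T _ _ _ _ _ hL₁ hL₁']

theorem flow_middle : ∀ (L₁ L₂ s T : List V) (j : V)
    (h : G.Applicable s (L₁ ++ j :: L₂)) (h' : G.Applicable s (j :: (L₁ ++ L₂)))
    (hT : T ⊆ (L₁ ++ j :: L₂).reverse ++ s) (hT' : T ⊆ (j :: (L₁ ++ L₂)).reverse ++ s)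
    (_ : (L₁ ++ j :: L₂ ++ s).Nodup),
    flow (L₁ ++ j :: L₂) s T h hT = flow (j :: (L₁ ++ L₂)) s T h' hT'
  | [], _, _, _, _, _, _, _, _, _ => rfl
  | i :: L₁, L₂, s, T, j, h, h', hT, hT', hn => by
    have hs : s.Nodup := List.Nodup.of_append_right hn
    have hn₁ : (L₁ ++ j :: L₂ ++ i :: s).Nodup := by
      rwa [List.nodup_middle]
    have hn₂ : (L₁ ++ L₂ ++ i :: j :: s).Nodup := by
      rw [List.nodup_middle, ← List.cons_append, List.nodup_middle]
      refine (List.Perm.nodup_iff ?_).1 hn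
      simpa using (List.perm_middle (l₁ := i :: L₁)).append_right s
    have hn₃ : (L₁ ++ L₂ ++ j :: i :: s).Nodup :=
      (List.Perm.nodup_iff ((List.Perm.swap j i s).append_left _)).1 hn₂
    have hij : (i :: j :: s).Nodup := List.Nodup.of_append_right hn₂
    have hji : (j :: i :: s).Nodup := List.Nodup.of_append_right hn₃
    have h₁ : G.Applicable (i :: s) (j :: (L₁ ++ L₂)) :=
      ⟨List.subset_cons_of_subset i h'.pa_subset, Applicable.erase_middle h.of_cons⟩
    have hT₁ : T ⊆ (j :: (L₁ ++ L₂)).reverse ++ i :: s := fun x hx => by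
      have := hT' hx
      simp at this ⊢
      tauto
    change flow (i :: (L₁ ++ j :: L₂)) s T h hT = flow (j :: i :: (L₁ ++ L₂)) s T h' hT'
    rw [flow_cons i _ s T hs,
      flow_middle L₁ L₂ (i :: s) T j _ h₁ _ hT₁ hn₁,
      flow_cons j _ (i :: s) T (List.nodup_cons.1 hji).2,
      flow_cons j _ s T hs,
      flow_cons i _ (j :: s) T (List.nodup_cons.1 hij).2, ← Category.assoc (step j s _),
      ← step_step i j s h.pa_subset h'.pa_subset hij _ _ (List.Perm.swap j i s).subset,
      Category.assoc, Category.assoc, multiplier_comp_flow _ _ _ _ _ _ _ _ _ hn₃ hn₂]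

theorem flow_perm : ∀ (L' L s T : List V) (_ : L.Perm L') (h : G.Applicable s L)
    (h' : G.Applicable s L') (hT : T ⊆ L.reverse ++ s) (hT' : T ⊆ L'.reverse ++ s)
    (_ : (L ++ s).Nodup), flow L s T h hT = flow L' s T h' hT'
  | [], L, s, T, hp, h, h', hT, hT', hn => by
    obtain rfl := hp.eq_nil
    rfl
  | j :: L', L, s, T, hp, h, h', hT, hT', hn => by
    obtain ⟨L₁, L₂, rfl⟩ := List.append_of_mem (hp.mem_iff.2 List.mem_cons_self)
    have hs : s.Nodup := List.Nodup.of_append_right hn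
    have hp' : (L₁ ++ L₂).Perm L' :=
      List.Perm.cons_inv (List.perm_middle.symm.trans hp)
    have h₁ : G.Applicable s (j :: (L₁ ++ L₂)) :=
      ⟨h'.pa_subset, Applicable.erase_middle h⟩
    have hT₁ : T ⊆ (j :: (L₁ ++ L₂)).reverse ++ s := fun x hx => by
      have := hT hx
      simp at this ⊢
      tauto
    have hn₁ : (L₁ ++ L₂ ++ j :: s).Nodup := by
      rw [List.nodup_middle]
      exact (List.Perm.nodup_iff (List.perm_middle.append_right s)).1 hn
    rw [flow_middle L₁ L₂ s T j h h₁ hT hT₁ hn, flow_cons j _ s T hs, flow_cons j _ s T hs,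
      flow_perm L' (L₁ ++ L₂) (j :: s) T hp' _ h'.of_cons _ (by simpa using hT') hn₁]

theorem flow_append : ∀ (L₁ L₂ s M T : List V) (h₁ : G.Applicable s L₁) (hM : M ⊆ L₁.reverse ++ s)
    (h₂ : G.Applicable M L₂) (hT₂ : T ⊆ L₂.reverse ++ M) (h : G.Applicable s (L₁ ++ L₂))
    (hT : T ⊆ (L₁ ++ L₂).reverse ++ s) (_ : (L₁ ++ L₂ ++ s).Nodup) (_ : (L₂ ++ M).Nodup),
    flow L₁ s M h₁ hM ≫ flow L₂ M T h₂ hT₂ = flow (L₁ ++ L₂) s T h hT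
  | [], L₂, s, M, T, h₁, hM, h₂, hT₂, h, hT, hn, hn' => by
    rw [flow_nil s M]
    exact multiplier_comp_flow L₂ s M T _ _ _ _ _ hn hn'
  | i :: L₁, L₂, s, M, T, h₁, hM, h₂, hT₂, h, hT, hn, hn' => by
    have hs : s.Nodup := List.Nodup.of_append_right hn
    have hn₁ : (L₁ ++ L₂ ++ i :: s).Nodup := by
      rwa [List.nodup_middle]
    rw [flow_cons i L₁ s M hs, Category.assoc,
      flow_append L₁ L₂ (i :: s) M T h₁.of_cons _ h₂ hT₂
        h.of_cons (by simpa using hT) hn₁ hn']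
    exact (flow_cons i (L₁ ++ L₂) s T hs _ _).symm

theorem joint_flow : ∀ (L s r T : List V) (hr : r ⊆ s) (h : G.Applicable s L)
    (hT : T ⊆ L.reverse ++ s) (hT' : r ++ T ⊆ L.reverse ++ s) (_ : (L ++ s).Nodup),
    joint (multiplier G s r hr) (flow L s T h hT) = flow L s (r ++ T) h hT'
  | [], s, r, T, hr, h, hT, hT', hn => by
    rw [flow_nil s T, flow_nil s (r ++ T)]
    exact (multiplier_append s r T hT').symm
  | i :: L, s, r, T, hr, h, hT, hT', hn => by
    have hs : s.Nodup := List.Nodup.of_append_right hn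
    have hn₁ : (L ++ i :: s).Nodup := by
      rwa [List.nodup_middle]
    have hi : i ∉ r := fun hi => (List.nodup_cons.1 hn).1 (List.mem_append_right _ (hr hi))
    rw [flow_cons i L s T hs, flow_cons i L s (r ++ T) hs, ← joint_appendMap, joint_step,
      Category.assoc, joint_appendMap, Category.id_comp,
      ← multiplier_cons_left i s r (List.subset_cons_of_subset i hr) hr hi,
      joint_flow L (i :: s) r T _ _ _ _ hn₁]

theorem joint_flow_right (L s r T : List V) (hr : r ⊆ s) (h : G.Applicable s L)
    (hT : T ⊆ L.reverse ++ s) (hT' : T ++ r ⊆ L.reverse ++ s) (hn : (L ++ s).Nodup)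
    (hrT : (r ++ T).Nodup) :
    joint (flow L s T h hT) (multiplier G s r hr) = flow L s (T ++ r) h hT' := by
  rw [← joint_swap, joint_flow L s r T hr h hT _ hn,
    swap_eq_multiplier hrT (by simp), flow_comp_multiplier]
  exact List.append_subset.2 ⟨(List.append_subset.1 hT').2, hT⟩

end CausalGraph

namespace Cau

open CausalGraph MarkovCategory

variable {V : Type u₀} {G : CausalGraph V}

instance copyable_fst (A B : List V) : Copyable (fst (of A : Cau G) (of B)) := by
  have h : Copyable ((𝟙 (of A : Cau G)) ⊗ₘ ε[(of B : Cau G)]) := inferInstance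
  have h' : Copyable (ρ_ (of A : Cau G)).hom := by
    rw [rightUnitor_hom_eq]; infer_instance
  exact copyable_comp _ _

theorem fst_eq_multiplier (A B : List V) (h : A ⊆ A ++ B) (hAB : (A ++ B).Nodup) :
    fst (of A : Cau G) (of B) = multiplier G (A ++ B) A h := by
  have h₁ := pair_fst (multiplier G (A ++ B) A h)
    (multiplier G (A ++ B) B (List.subset_append_right A B))
  have h₂ := multiplier_append (G := G) (A ++ B) A B (List.Subset.refl _)
  rw [multiplier_self _ _ hAB] at h₂
  rw [← h₁]
  exact (Category.id_comp _).symm.trans (congrArg (· ≫ fst (of A : Cau G) (of B)) h₂)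

theorem comul_whiskerRight_associator (A B : List V) (h : A ⊆ A ++ B) (hAB : (A ++ B).Nodup) :
    (Δ[(of A : Cau G)] ▷ of B) ≫ (α_ (of A) (of A) (of B)).hom =
      joint (multiplier G (A ++ B) A h) (𝟙 (of (A ++ B))) := by
  have h₁ : (Δ[(of A : Cau G)] ▷ of B) ≫ (α_ (of A) (of A) (of B)).hom =
      pair (fst (of A) (of B)) (𝟙 (of A ⊗ of B)) := by
    rw [← Category.id_comp (Δ[(of A : Cau G)] ▷ of B), ← pair_fst_snd, pair_whiskerRight,
      Copyable.comp_comul, pair_associator]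
  rw [h₁, fst_eq_multiplier A B h hAB]
  rfl

end Cau

namespace CausalGraph

open Cau MarkovCategory

variable {V : Type u₀} {G : CausalGraph V}

theorem applicable_append : ∀ {L₁ L₂ s : List V}, G.Applicable s L₁ →
    G.Applicable (L₁.reverse ++ s) L₂ → G.Applicable s (L₁ ++ L₂)
  | [], _, _, _, h => h
  | _ :: _, _, _, h₁, h₂ => ⟨h₁.1, applicable_append h₁.2 (by simpa using h₂)⟩

variable [Finite V]

theorem nodup_effectNodes_append (t v : List V) (ht : t.Nodup) :
    (G.effectNodes t v ++ t).Nodup := by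
  refine List.Nodup.append ?_ ht fun x hx => (mem_effectNodes.1 hx).2
  exact (topologicalOrder_spec G).1.filter _

theorem subset_effectNodes_append (u v : List V) :
    v ++ u ⊆ (G.effectNodes u v).reverse ++ u :=
  List.append_subset.2 ⟨G.subset_effectNodes u v, List.subset_append_right _ _⟩

theorem append_subset_effectNodes (u v w : List V) :
    v ++ w ⊆ (G.effectNodes (v ++ u) w).reverse ++ (v ++ u) :=
  List.append_subset.2 ⟨by intro x hx; simp [hx], G.subset_effectNodes (v ++ u) w⟩

/-- Decomposability says that the mechanisms of `[v ‖ u]` followed by those of `[w ‖ vu]` yield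
`[vw ‖ u]`. -/
theorem decomposable_iff {u v w : List V} (hu : u.Nodup) (hv : v.Nodup) (huv : u.Disjoint v) :
    G.Decomposable u v w ↔ G.effect (v ++ w) u =
      flow (G.effectNodes u v) u (v ++ u) (G.applicable_effectNodes u v)
          (subset_effectNodes_append u v) ≫
        flow (G.effectNodes (v ++ u) w) (v ++ u) (v ++ w) (G.applicable_effectNodes (v ++ u) w)
          (append_subset_effectNodes u v w) := by
  have hvu : (v ++ u).Nodup := hv.append hu huv.symm
  have huv' : (u ++ v).Nodup := hu.append hv huv
  have hA := nodup_effectNodes_append (G := G) u v hu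
  have hB := nodup_effectNodes_append (G := G) (v ++ u) w hvu
  have h₁ : Δ[(of u : Cau G)] ≫ (G.effect v u ▷ of u) =
      flow (G.effectNodes u v) u (v ++ u) (G.applicable_effectNodes u v)
        (subset_effectNodes_append u v) := by
    rw [← joint_flow_right _ u u v (List.Subset.refl u) _ (G.subset_effectNodes u v) _ hA huv',
      multiplier_self u _ hu, ← pair_id_id, pair_whiskerRight, Category.id_comp]
    rfl
  have h₂ : joint (multiplier G (v ++ u) v (List.subset_append_left v u)) (𝟙 (of (v ++ u))) ≫
        appendMap v (G.effect w (v ++ u)) =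
      flow (G.effectNodes (v ++ u) w) (v ++ u) (v ++ w) (G.applicable_effectNodes (v ++ u) w)
        (append_subset_effectNodes u v w) := by
    rw [joint_appendMap, Category.id_comp]
    exact joint_flow _ _ _ _ _ _ _ _ hB
  rw [Decomposable, ← h₂, ← h₁, ← comul_whiskerRight_associator v u _ hvu]
  simp only [Category.assoc]
  rfl

theorem decomposable_of_perm {u v w : List V} (hu : u.Nodup) (hv : v.Nodup) (huv : u.Disjoint v)
    (hp : (G.effectNodes u (v ++ w)).Perm (G.effectNodes u v ++ G.effectNodes (v ++ u) w)) :
    G.Decomposable u v w := by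
  have hvu : (v ++ u).Nodup := hv.append hu huv.symm
  have hB := nodup_effectNodes_append (G := G) (v ++ u) w hvu
  have hC := nodup_effectNodes_append (G := G) u (v ++ w) hu
  have hAB : (G.effectNodes u v ++ G.effectNodes (v ++ u) w ++ u).Nodup :=
    (List.Perm.nodup_iff (hp.append_right u)).1 hC
  have happ : G.Applicable u (G.effectNodes u v ++ G.effectNodes (v ++ u) w) :=
    applicable_append (G.applicable_effectNodes u v)
      ((G.applicable_effectNodes (v ++ u) w).mono (subset_effectNodes_append u v))
  have hT : v ++ w ⊆ (G.effectNodes u v ++ G.effectNodes (v ++ u) w).reverse ++ u := fun x hx => by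
    have := G.subset_effectNodes u (v ++ w) hx
    simp only [List.mem_append, List.mem_reverse, hp.mem_iff] at this ⊢
    exact this
  rw [decomposable_iff hu hv huv, flow_append _ _ _ _ _ _ _ _ _ happ hT hAB hB]
  exact flow_perm _ _ _ _ hp _ _ _ _ hC

end CausalGraph

namespace CausalGraph

variable {V : Type u₀} {G : CausalGraph V} {t t' v : List V} {i k x y z : V}

/-! ### Ancestors -/

/-- `G.Reaches t x y`: there is a directed path from `x` to `y`, possibly without arrows, whose
vertices after the start are not in `t`. -/
def Reaches (G : CausalGraph V) (t : List V) : V → V → Prop :=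
  Relation.ReflTransGen fun x y => G.Adj x y ∧ y ∉ t

theorem Reaches.mono (h : G.Reaches t x y) (ht : t' ⊆ t) : G.Reaches t' x y :=
  Relation.ReflTransGen.mono (fun _ _ hxy => ⟨hxy.1, fun hy => hxy.2 (ht hy)⟩) _ _ h

theorem reaches_of_chain : ∀ (q : List V) (x : V), (x :: q).IsChain G.Adj →
    (x :: q).getLast? = some y → (∀ z ∈ q, z ∉ t) → ∀ i ∈ x :: q, G.Reaches t i y
  | [], x, _, hl, _, i, hi => by
    obtain rfl : x = y := by simpa using hl
    obtain rfl : i = x := by simpa using hi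
    exact Relation.ReflTransGen.refl
  | z :: q, x, hc, hl, hq, i, hi => by
    rw [List.isChain_cons_cons] at hc
    rw [List.getLast?_cons_cons] at hl
    have ih := reaches_of_chain q z hc.2 hl fun z hz => hq z (List.mem_cons_of_mem _ hz)
    rcases List.mem_cons.1 hi with rfl | hi
    · exact Relation.ReflTransGen.head ⟨hc.1, hq z List.mem_cons_self⟩ (ih z List.mem_cons_self)
    · exact ih i hi

theorem transGen_of_chain : ∀ (q : List V) (x : V), (x :: q).IsChain G.Adj →
    ∀ i ∈ q, Relation.TransGen G.Adj x i
  | [], _, _, _, hi => absurd hi List.not_mem_nil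
  | z :: q, x, hc, i, hi => by
    rw [List.isChain_cons_cons] at hc
    rcases List.mem_cons.1 hi with rfl | hi
    · exact Relation.TransGen.single hc.1
    · exact Relation.TransGen.head hc.1 (transGen_of_chain q z hc.2 i hi)

/-- If `x` reaches a set, then there is a path to the first vertex in that set. -/
theorem Reaches.exists_chain {S : Set V} (h : G.Reaches t x y) (hy : y ∈ S) :
    ∃ q, ∃ i ∈ S, (x :: q).IsChain G.Adj ∧ (x :: q).getLast? = some i ∧ (∀ z ∈ q, z ∉ t) ∧
      ∀ z ∈ x :: q, z ∈ S → z = i := by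
  induction h using Relation.ReflTransGen.head_induction_on with
  | refl => exact ⟨[], y, hy, by simp, by simp, by simp, by simp⟩
  | @head x z hxz _ ih =>
    by_cases hx : x ∈ S
    · exact ⟨[], x, hx, by simp, by simp, by simp, by simp⟩
    · obtain ⟨q, i, hi, hc, hl, hq, hS⟩ := ih
      refine ⟨z :: q, i, hi, List.isChain_cons_cons.2 ⟨hxz.1, hc⟩, ?_, ?_, ?_⟩
      · rwa [List.getLast?_cons_cons]
      · exact List.forall_mem_cons.2 ⟨hxz.2, hq⟩
      · exact List.forall_mem_cons.2 ⟨fun h => absurd h hx, hS⟩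

theorem Reaches.through_or_avoids (v : List V) (h : G.Reaches t x y) :
    (∃ z ∈ v, G.Reaches t x z) ∨ (x ∉ v ∧ G.Reaches (v ++ t) x y) := by
  induction h using Relation.ReflTransGen.head_induction_on with
  | refl =>
    by_cases hy : y ∈ v
    · exact Or.inl ⟨y, hy, Relation.ReflTransGen.refl⟩
    · exact Or.inr ⟨hy, Relation.ReflTransGen.refl⟩
  | @head x z hxz _ ih =>
    by_cases hx : x ∈ v
    · exact Or.inl ⟨x, hx, Relation.ReflTransGen.refl⟩
    · rcases ih with ⟨a, ha, hza⟩ | ⟨hz, hzy⟩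
      · exact Or.inl ⟨a, ha, hza.head hxz⟩
      · exact Or.inr ⟨hx, hzy.head ⟨hxz.1, by simp [hz, hxz.2]⟩⟩

theorem mem_effectNodes_iff [Finite V] :
    i ∈ G.effectNodes t v ↔ i ∉ t ∧ ∃ y ∈ v, G.Reaches t i y := by
  rw [mem_effectNodes, and_comm]
  refine and_congr_right fun hit => ⟨?_, ?_⟩
  · rintro (h | h | ⟨x, q, y, ⟨-, hc, hl⟩, hy, hq, hi⟩)
    · exact absurd h hit
    · exact ⟨i, h, Relation.ReflTransGen.refl⟩
    · exact ⟨y, hy, reaches_of_chain q x hc hl hq i hi⟩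
  · rintro ⟨y, hy, h⟩
    obtain ⟨q, j, hj, hc, hl, hq, -⟩ := h.exists_chain (S := {y | y ∈ v}) hy
    by_cases hq₀ : q = []
    · subst hq₀
      obtain rfl : i = j := by simpa using hl
      exact Or.inr (Or.inl hj)
    · exact Or.inr (Or.inr ⟨i, q, j, ⟨hq₀, hc, hl⟩, hj, hq, List.mem_cons_self⟩)

variable {u w : List V}

theorem perm_effectNodes [Finite V]
    (hd : (G.effectNodes u v).Disjoint (G.effectNodes (v ++ u) w)) :
    (G.effectNodes u (v ++ w)).Perm (G.effectNodes u v ++ G.effectNodes (v ++ u) w) := by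
  have hn : ∀ t v, (G.effectNodes t v).Nodup := fun t v => (topologicalOrder_spec G).1.filter _
  refine (List.perm_ext_iff_of_nodup (hn _ _) ((hn _ _).append (hn _ _) hd)).2 fun x => ?_
  simp only [List.mem_append, mem_effectNodes_iff]
  constructor
  · rintro ⟨hx, y, hy | hy, h⟩
    · exact Or.inl ⟨hx, y, hy, h⟩
    · rcases h.through_or_avoids v with ⟨z, hz, hxz⟩ | ⟨hxv, hxy⟩
      · exact Or.inl ⟨hx, z, hz, hxz⟩
      · exact Or.inr ⟨not_or.2 ⟨hxv, hx⟩, y, hy, hxy⟩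
  · rintro (⟨hx, y, hy, h⟩ | ⟨hx, y, hy, h⟩)
    · exact ⟨hx, y, Or.inl hy, h⟩
    · exact ⟨(not_or.1 hx).2, y, Or.inr hy, h.mono (List.subset_append_right _ _)⟩

theorem IsDirPath.end_mem {q : List V} (h : G.IsDirPath x q y) : y ∈ q := by
  obtain ⟨hne, -, hl⟩ := h
  cases q with
  | nil => exact absurd rfl hne
  | cons a q =>
    rw [List.getLast?_cons_cons] at hl
    exact List.mem_of_getLast? hl

theorem IsDirPath.reaches {q : List V} (h : G.IsDirPath x q y) (hq : ∀ z ∈ q, z ∉ t) :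
    G.Reaches t x y :=
  reaches_of_chain q x h.2.1 h.2.2 hq x List.mem_cons_self

theorem backwardTSeparated_of_disjoint [Finite V] (hvw : v.Disjoint w)
    (hd : (G.effectNodes u v).Disjoint (G.effectNodes (v ++ u) w)) :
    G.BackwardTSeparated {x | x ∈ v} {x | x ∈ w} {x | x ∈ u} := by
  rintro l ⟨i, hi, j, hj, htrek, hl⟩
  by_contra! hlu
  simp only [Set.mem_ofPred_eq] at hi hj hl hlu
  simp only [List.Disjoint, mem_effectNodes_iff, List.mem_append, not_or] at hd
  cases htrek with
  | @directed q hq =>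
    refine hd (a := j) ⟨hlu j (by simp), i, hi, hq.reaches fun z hz => hlu z (by simp [hz])⟩
      ⟨⟨fun h => hvw h hj, hlu j (by simp)⟩, j, hj, Relation.ReflTransGen.refl⟩
  | @fork k p q hp hq hki hkj hpq =>
    refine hd (a := k) ⟨hlu k (by simp), i, hi, hp.reaches fun z hz => hlu z (by simp [hz])⟩
      ⟨⟨(hl k (by simp) hki hkj).1, hlu k (by simp)⟩, j, hj, hq.reaches fun z hz => ?_⟩
    have hzv : z ∉ v := by
      by_cases hzj : z = j
      · subst hzj
        exact fun h => hvw h hj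
      · refine (hl z (by simp [hz]) ?_ hzj).1
        rintro rfl
        exact hpq hp.end_mem hz
    simp [hzv, hlu z (by simp [hz])]

theorem disjoint_of_backwardTSeparated [Finite V]
    (h : G.BackwardTSeparated {x | x ∈ v} {x | x ∈ w} {x | x ∈ u}) :
    (G.effectNodes u v).Disjoint (G.effectNodes (v ++ u) w) := by
  intro k₀ hk₀ hk₀'
  have hwf : WellFounded (flip (Relation.TransGen G.Adj)) := by
    have : Std.Irrefl (flip (Relation.TransGen G.Adj)) := ⟨G.acyclic⟩
    have : IsTrans V (flip (Relation.TransGen G.Adj)) := ⟨fun _ _ _ h₁ h₂ => h₂.trans h₁⟩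
    exact Finite.wellFounded_of_trans_of_irrefl _
  obtain ⟨k, ⟨hk, hk'⟩, hmax⟩ := hwf.has_min
    {k | k ∈ G.effectNodes u v ∧ k ∈ G.effectNodes (v ++ u) w} ⟨k₀, hk₀, hk₀'⟩
  rw [mem_effectNodes_iff] at hk hk'
  obtain ⟨hku, y, hy, hky⟩ := hk
  obtain ⟨hkvu, y', hy', hky'⟩ := hk'
  obtain ⟨p, i, hi, hpc, hpl, hpu, hpv⟩ := hky.exists_chain (S := {x | x ∈ v}) hy
  obtain ⟨q, j, hj, hqc, hql, hqvu, hqw⟩ := hky'.exists_chain (S := {x | x ∈ w}) hy'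
  simp only [Set.mem_ofPred_eq] at hi hj hpv hqw
  simp only [List.mem_append, not_or] at hkvu hqvu
  have hpA : ∀ z ∈ p, z ∈ G.effectNodes u v := fun z hz => mem_effectNodes_iff.2
    ⟨hpu z hz, i, hi, reaches_of_chain p k hpc hpl hpu z (List.mem_cons_of_mem _ hz)⟩
  have hpB : ∀ z ∈ p, z ∉ G.effectNodes (v ++ u) w := fun z hz hzB =>
    hmax z ⟨hpA z hz, hzB⟩ (transGen_of_chain p k hpc z hz)
  have hpw : ∀ z ∈ p, z ∉ v → z ∉ w := fun z hz hzv hzw =>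
    hpB z hz (mem_effectNodes_iff.2
      ⟨by simp [hzv, hpu z hz], z, hzw, Relation.ReflTransGen.refl⟩)
  have hki : k ≠ i := fun e => hkvu.1 (e ▸ hi)
  have hp₀ : p ≠ [] := fun e => by
    subst e
    exact hki (by simpa using hpl)
  have hp : G.IsDirPath k p i := ⟨hp₀, hpc, hpl⟩
  by_cases hkj : k = j
  · subst hkj
    have hproper : ∀ z ∈ k :: p, z ≠ i → z ≠ k → z ∉ v ∧ z ∉ w := fun z hz hzi hzk => by
      have hzv : z ∉ v := fun hzv => hzi (hpv z hz hzv)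
      exact ⟨hzv, hpw z ((List.mem_cons.1 hz).resolve_left hzk) hzv⟩
    obtain ⟨z, hz, hzu⟩ := h (k :: p) ⟨i, hi, k, hj, .directed hp, hproper⟩
    rcases List.mem_cons.1 hz with rfl | hz
    · exact hku hzu
    · exact hpu z hz hzu
  · have hq : G.IsDirPath k q j := ⟨fun e => by subst e; exact hkj (by simpa using hql), hqc, hql⟩
    have hkw : k ∉ w := fun hkw => hkj (hqw k List.mem_cons_self hkw)
    have hpq : p.Disjoint q := fun z hz hz' => hpB z hz (mem_effectNodes_iff.2
      ⟨by simp [hqvu z hz'], j, hj, reaches_of_chain q k hqc hql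
        (fun z hz => by simp [hqvu z hz]) z (List.mem_cons_of_mem _ hz')⟩)
    have hproper : ∀ z ∈ k :: (p ++ q), z ≠ i → z ≠ j → z ∉ v ∧ z ∉ w := fun z hz hzi hzj => by
      rcases List.mem_cons.1 hz with rfl | hz
      · exact ⟨hkvu.1, hkw⟩
      · rcases List.mem_append.1 hz with hz | hz
        · have hzv : z ∉ v := fun hzv => hzi (hpv z (List.mem_cons_of_mem _ hz) hzv)
          exact ⟨hzv, hpw z hz hzv⟩
        · exact ⟨(hqvu z hz).1, fun hzw => hzj (hqw z (List.mem_cons_of_mem _ hz) hzw)⟩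
    obtain ⟨z, hz, hzu⟩ := h (k :: (p ++ q)) ⟨i, hi, j, hj, .fork hp hq hki hkj hpq, hproper⟩
    rcases List.mem_cons.1 hz with rfl | hz
    · exact hku hzu
    · rcases List.mem_append.1 hz with hz | hz
      · exact hpu z hz hzu
      · exact (hqvu z hz).2 hzu

end CausalGraph

namespace CausalGraph.Term

variable {V : Type u₀} {G : CausalGraph V} {A B C D : List V}

/-! ### Counting effective noise sources

Every morphism is interpreted as a map of Boolean vectors, each mechanism being the disjunction of
its inputs. A fixed mechanism has moreover a source of noise that feeds `true` into its output, and
we count the sources whose effect is visible to an observable of the output. -/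

/-- The action on Boolean vectors. -/
def act : ∀ {A B : List V}, Term G A B → List Bool → List Bool
  | _, _, .id _, x => x
  | _, _, .comp f g, x => g.act (f.act x)
  | _, _, .tensor (A := A) f g, x => f.act (x.take A.length) ++ g.act (x.drop A.length)
  | _, _, .swap A _, x => x.drop A.length ++ x.take A.length
  | _, _, .copy _, x => x ++ x
  | _, _, .discard _, _ => []
  | _, _, .mech _, x => [x.any fun b => b]

open scoped Classical in
/-- The number of occurrences of the mechanism of `k` whose noise is visible to `φ`. -/
noncomputable def visible (k : V) : ∀ {A B : List V}, Term G A B → (List Bool → Bool) → ℕ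
  | _, _, .id _, _ => 0
  | _, _, .comp f g, φ => f.visible k (fun y => φ (g.act y)) + g.visible k φ
  | _, _, .tensor (B := B) (D := D) f g, φ =>
    f.visible k (fun y => φ (y ++ List.replicate D.length false)) +
      g.visible k (fun y => φ (List.replicate B.length false ++ y))
  | _, _, .swap _ _, _ => 0
  | _, _, .copy _, _ => 0
  | _, _, .discard _, _ => 0
  | _, _, .mech a, φ => if a = k ∧ φ [true] = true then 1 else 0

theorem act_ofEq (h : A = B) (x : List Bool) : (ofEq G h).act x = x := by
  subst h; rfl

theorem visible_ofEq (k : V) (h : A = B) (φ : List Bool → Bool) : (ofEq G h).visible k φ = 0 := by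
  subst h; rfl

theorem length_act : ∀ {A B : List V} (f : Term G A B) {x : List Bool},
    x.length = A.length → (f.act x).length = B.length
  | _, _, .id _, _, hx => hx
  | _, _, .comp f g, _, hx => length_act g (length_act f hx)
  | _, _, .tensor f g, x, hx => by
    rw [List.length_append] at hx
    rw [act, List.length_append, length_act f (by simp [hx]), length_act g (by simp [hx]),
      List.length_append]
  | _, _, .swap A B, x, hx => by
    rw [List.length_append] at hx
    simp [act, hx]
  | _, _, .copy _, _, hx => by simp [act, hx]
  | _, _, .discard _, _, _ => rfl
  | _, _, .mech _, _, _ => rfl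

theorem act_replicate : ∀ {A B : List V} (f : Term G A B),
    f.act (List.replicate A.length false) = List.replicate B.length false
  | _, _, .id _ => rfl
  | _, _, .comp f g => by rw [act, act_replicate f, act_replicate g]
  | _, _, .tensor (A := A) f g => by
    have hf := act_replicate f
    have hg := act_replicate g
    simp [act, hf, hg]
  | _, _, .swap A B => by simp [act, Nat.add_comm]
  | _, _, .copy _ => by simp [act]
  | _, _, .discard _ => rfl
  | _, _, .mech _ => by simp [act]

theorem act_tensor_append (f : Term G A B) (g : Term G C D) {x y : List Bool}
    (hx : x.length = A.length) : (f.tensor g).act (x ++ y) = f.act x ++ g.act y := by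
  rw [act, List.take_left' hx, List.drop_left' hx]

theorem act_swap_append {x y : List Bool} (hx : x.length = A.length) :
    (swap (G := G) A B).act (x ++ y) = y ++ x := by
  rw [act, List.take_left' hx, List.drop_left' hx]

theorem exists_append_of_length {x : List Bool} (hx : x.length = (A ++ B).length) :
    ∃ y z, x = y ++ z ∧ y.length = A.length ∧ z.length = B.length := by
  rw [List.length_append] at hx
  exact ⟨x.take A.length, x.drop A.length, (List.take_append_drop _ _).symm, by simp [hx],
    by simp [hx]⟩

theorem Rel.act_eq {f g : Term G A B} (h : Rel G f g) :
    ∀ x : List Bool, x.length = A.length → f.act x = g.act x := by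
  induction h with
  | refl f => exact fun _ _ => rfl
  | symm _ ih => exact fun x hx => (ih x hx).symm
  | trans _ _ ih₁ ih₂ => exact fun x hx => (ih₁ x hx).trans (ih₂ x hx)
  | @comp_congr _ _ _ f f' g g' _ _ ih₁ ih₂ =>
    intro x hx
    rw [act, act, ih₁ x hx, ih₂ _ (length_act f' hx)]
  | tensor_congr _ _ ih₁ ih₂ =>
    intro x hx
    obtain ⟨y, z, rfl, hy, hz⟩ := exists_append_of_length hx
    rw [act_tensor_append _ _ hy, act_tensor_append _ _ hy, ih₁ y hy, ih₂ z hz]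
  | id_comp | comp_id | assoc => exact fun _ _ => rfl
  | tensor_id => exact fun x hx => by simp [act]
  | tensor_comp f g f' g' =>
    intro x hx
    obtain ⟨y, z, rfl, hy, hz⟩ := exists_append_of_length hx
    rw [act, act_tensor_append _ _ hy, act_tensor_append _ _ (length_act f hy),
      act_tensor_append _ _ hy, act, act]
  | tensor_assoc f g h =>
    intro x hx
    obtain ⟨w, z, rfl, hw, hz⟩ := exists_append_of_length hx
    rw [act, act_ofEq, act_tensor_append _ _ hw, act, act_ofEq]
    obtain ⟨x, y, rfl, hx, hy⟩ := exists_append_of_length hw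
    rw [List.append_assoc, act_tensor_append _ _ hx, act_tensor_append _ _ hx,
      act_tensor_append _ _ hy, List.append_assoc]
  | unit_tensor f => exact fun x hx => by simp [act]
  | tensor_unit f =>
    intro x hx
    obtain ⟨y, z, rfl, hy, hz⟩ := exists_append_of_length hx
    obtain rfl : z = [] := List.eq_nil_of_length_eq_zero hz
    rw [act, act_ofEq, act_tensor_append _ _ hy]
    simp [act, act_ofEq]
  | swap_natural f g =>
    intro x hx
    obtain ⟨y, z, rfl, hy, hz⟩ := exists_append_of_length hx
    rw [act, act_tensor_append _ _ hy, act_swap_append (length_act f hy), act,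
      act_swap_append hy, act_tensor_append _ _ hz]
  | swap_swap A B =>
    intro x hx
    obtain ⟨y, z, rfl, hy, hz⟩ := exists_append_of_length hx
    change (swap B A).act ((swap A B).act (y ++ z)) = y ++ z
    rw [act_swap_append hy, act_swap_append hz]
  | hexagon A B C =>
    intro x hx
    obtain ⟨w, z, rfl, hw, hz⟩ := exists_append_of_length hx
    obtain ⟨x, y, rfl, hx, hy⟩ := exists_append_of_length hw
    have h₁ : (swap A (B ++ C) : Term G _ _).act (x ++ (y ++ z)) = (y ++ z) ++ x :=
      act_swap_append hx
    have h₂ : ((swap A B).tensor (id C) : Term G _ _).act ((x ++ y) ++ z) = y ++ (x ++ z) := by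
      rw [act_tensor_append _ _ hw, act_swap_append hx, List.append_assoc]
      rfl
    have h₃ : ((id B).tensor (swap A C) : Term G _ _).act (y ++ (x ++ z)) = y ++ (z ++ x) := by
      rw [act_tensor_append _ _ hy, act_swap_append hx]
      rfl
    rw [act, act_ofEq, act, act_ofEq, act, h₂, act, act_ofEq, h₃, List.append_assoc x y z, h₁,
      List.append_assoc]
  | copy_assoc A =>
    intro x hx
    simp [act, act_ofEq, hx, List.take_left', List.drop_left']
  | discard_copy A =>
    intro x hx
    simp [act, hx, List.drop_left']
  | copy_discard A =>
    intro x hx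
    simp [act, act_ofEq, hx, List.take_left']
  | copy_swap A =>
    intro x hx
    simp [act, hx, List.take_left', List.drop_left']
  | copy_tensor A B =>
    intro x hx
    obtain ⟨y, z, rfl, hy, hz⟩ := exists_append_of_length hx
    have h : (((id A).tensor ((swap A B).tensor (id B))) : Term G _ _).act
        (y ++ ((y ++ z) ++ z)) = y ++ ((z ++ y) ++ z) := by
      rw [act_tensor_append _ _ hy, act_tensor_append _ _ (by simp [hy, hz]), act_swap_append hy]
      rfl
    have h' : ((copy A).tensor (copy B) : Term G _ _).act (y ++ z) = y ++ ((y ++ z) ++ z) := by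
      rw [act_tensor_append _ _ hy]
      simp [act]
    rw [act, h', act, act_ofEq, act, act_ofEq, h]
    simp [act]
  | discard_tensor | copy_unit | discard_unit | discard_natural =>
    intro x hx
    first
      | rfl
      | (obtain rfl : x = [] := List.eq_nil_of_length_eq_zero hx
         rfl)

theorem visible_congr (k : V) : ∀ {A B : List V} (f : Term G A B) {φ φ' : List Bool → Bool},
    (∀ y : List Bool, y.length = B.length → φ y = φ' y) → f.visible k φ = f.visible k φ'
  | _, _, .id _, _, _, _ => rfl
  | _, _, .comp f g, φ, φ', h => by
    rw [visible, visible, visible_congr k g h,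
      visible_congr k f fun y hy => h _ (length_act g hy)]
  | _, _, .tensor f g, φ, φ', h => by
    rw [visible, visible, visible_congr k f fun y hy => h _ (by simp [hy]),
      visible_congr k g fun y hy => h _ (by simp [hy])]
  | _, _, .swap _ _, _, _, _ => rfl
  | _, _, .copy _, _, _, _ => rfl
  | _, _, .discard _, _, _, _ => rfl
  | _, _, .mech _, _, _, h => by rw [visible, visible, h [true] rfl]

theorem visible_false (k : V) : ∀ {A B : List V} (f : Term G A B),
    f.visible k (fun _ => false) = 0
  | _, _, .id _ => rfl
  | _, _, .comp f g => by rw [visible, visible_false k f, visible_false k g]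
  | _, _, .tensor f g => by rw [visible, visible_false k f, visible_false k g]
  | _, _, .swap _ _ => rfl
  | _, _, .copy _ => rfl
  | _, _, .discard _ => rfl
  | _, _, .mech _ => by simp [visible]

theorem Rel.visible_eq (k : V) {f g : Term G A B} (h : Rel G f g) :
    ∀ φ : List Bool → Bool, φ (List.replicate B.length false) = false →
      f.visible k φ = g.visible k φ := by
  induction h with
  | refl f => exact fun _ _ => rfl
  | symm _ ih => exact fun φ hφ => (ih φ hφ).symm
  | trans _ _ ih₁ ih₂ => exact fun φ hφ => (ih₁ φ hφ).trans (ih₂ φ hφ)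
  | @comp_congr _ _ _ f f' g g' h₁ h₂ ih₁ ih₂ =>
    intro φ hφ
    rw [visible, visible, ih₂ φ hφ, ih₁ _ (by rw [act_replicate, hφ]),
      visible_congr k f' fun y hy => congrArg φ (h₂.act_eq y hy)]
  | tensor_congr _ _ ih₁ ih₂ =>
    intro φ hφ
    rw [List.length_append, List.replicate_add] at hφ
    rw [visible, visible, ih₁ _ hφ, ih₂ _ hφ]
  | id_comp f => exact fun _ _ => by simp [visible]
  | comp_id f => exact fun _ _ => by simp [visible, act]
  | assoc f g h => exact fun _ _ => by simp [visible, act, Nat.add_assoc]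
  | tensor_id => exact fun _ _ => by simp [visible]
  | tensor_comp f g f' g' =>
    intro φ hφ
    simp only [visible]
    rw [visible_congr k f fun y hy => by rw [act_tensor_append g g' hy, act_replicate g'],
      visible_congr k f' fun y hy => by
        rw [act_tensor_append g g' (List.length_replicate), act_replicate g]]
    omega
  | tensor_assoc f g h =>
    intro φ hφ
    simp only [visible, visible_ofEq, act_ofEq, List.length_append, List.replicate_add,
      List.append_assoc]
    omega
  | unit_tensor f => exact fun _ _ => by simp [visible]
  | tensor_unit f => exact fun _ _ => by simp [visible, visible_ofEq, act_ofEq]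
  | @swap_natural A B C D f g =>
    intro φ hφ
    simp only [visible]
    rw [visible_congr k f fun y hy => by rw [act_swap_append hy],
      visible_congr k g fun y hy => by rw [act_swap_append (List.length_replicate)]]
    omega
  | discard_natural f =>
    intro φ hφ
    simp only [visible, act]
    rw [show φ [] = false from hφ, visible_false]
  | _ => exact fun _ _ => by simp [visible, visible_ofEq]

end CausalGraph.Term

namespace Cau

open CausalGraph MarkovCategory

variable {V : Type u₀} {G : CausalGraph V} {X Y Z W : Cau G} {A B : List V} {b i k : V}

/-- The action of a morphism on Boolean vectors (of the correct length). -/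
def act (f : X ⟶ Y) (x : List Bool) : List Bool :=
  Quotient.lift (fun t : Term G X.word Y.word => if x.length = X.word.length then t.act x else [])
    (fun t t' (h : Term.Rel G t t') => by
      split_ifs with hx
      · exact h.act_eq x hx
      · rfl) f

/-- The number of occurrences of the mechanism of `k` whose noise is visible to an observable
vanishing at zero. -/
noncomputable def visible (k : V) (f : X ⟶ Y) (φ : List Bool → Bool) : ℕ :=
  Quotient.lift (fun t : Term G X.word Y.word =>
      if φ (List.replicate Y.word.length false) = false then t.visible k φ else 0)
    (fun t t' (h : Term.Rel G t t') => by
      split_ifs with hφ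
      · exact h.visible_eq k φ hφ
      · rfl) f

theorem act_mk (t : Term G A B) {x : List Bool} (hx : x.length = A.length) :
    act (mk t) x = t.act x :=
  if_pos hx

theorem visible_mk (t : Term G A B) {φ : List Bool → Bool}
    (hφ : φ (List.replicate B.length false) = false) : visible k (mk t) φ = t.visible k φ :=
  if_pos hφ

theorem act_replicate (f : X ⟶ Y) :
    act f (List.replicate X.word.length false) = List.replicate Y.word.length false := by
  obtain ⟨t, rfl⟩ := exists_mk f
  rw [act_mk t List.length_replicate]
  exact Term.act_replicate t

theorem act_comp (f : X ⟶ Y) (g : Y ⟶ Z) {x : List Bool} (hx : x.length = X.word.length) :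
    act (f ≫ g) x = act g (act f x) := by
  obtain ⟨s, rfl⟩ := exists_mk f
  obtain ⟨t, rfl⟩ := exists_mk g
  rw [act_mk s hx, act_mk t (Term.length_act s hx)]
  exact act_mk (s.comp t) hx

theorem visible_comp (f : X ⟶ Y) (g : Y ⟶ Z) {φ : List Bool → Bool}
    (hφ : φ (List.replicate Z.word.length false) = false) :
    visible k (f ≫ g) φ = visible k f (fun y => φ (act g y)) + visible k g φ := by
  obtain ⟨s, rfl⟩ := exists_mk f
  obtain ⟨t, rfl⟩ := exists_mk g
  rw [visible_mk t hφ, visible_mk s (by rw [act_replicate]; exact hφ),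
    Term.visible_congr k s fun y hy => congrArg φ (act_mk t hy)]
  exact visible_mk (s.comp t) hφ

theorem act_tensorHom (f : X ⟶ Y) (g : Z ⟶ W) {x y : List Bool} (hx : x.length = X.word.length)
    (hy : y.length = Z.word.length) : act (f ⊗ₘ g) (x ++ y) = act f x ++ act g y := by
  obtain ⟨s, rfl⟩ := exists_mk f
  obtain ⟨t, rfl⟩ := exists_mk g
  rw [act_mk s hx, act_mk t hy, ← Term.act_tensor_append s t hx]
  exact act_mk (s.tensor t) (by simp [hx, hy])

theorem visible_tensorHom (f : X ⟶ Y) (g : Z ⟶ W) {φ : List Bool → Bool}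
    (hφ : φ (List.replicate (Y ⊗ W).word.length false) = false) :
    visible k (f ⊗ₘ g) φ =
      visible k f (fun y => φ (y ++ List.replicate W.word.length false)) +
        visible k g (fun y => φ (List.replicate Y.word.length false ++ y)) := by
  obtain ⟨s, rfl⟩ := exists_mk f
  obtain ⟨t, rfl⟩ := exists_mk g
  have h : φ (List.replicate Y.word.length false ++ List.replicate W.word.length false) = false := by
    rw [← List.replicate_add, ← List.length_append]; exact hφ
  rw [visible_mk t h, visible_mk s h]
  exact visible_mk (s.tensor t) hφ

theorem act_id {x : List Bool} (hx : x.length = X.word.length) : act (𝟙 X) x = x :=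
  act_mk (Term.id X.word) hx

theorem visible_id (φ : List Bool → Bool) : visible k (𝟙 X) φ = 0 :=
  ite_self 0

theorem act_eqToHom (h : X = Y) {x : List Bool} (hx : x.length = X.word.length) :
    act (eqToHom h) x = x := by
  subst h; exact act_id hx

theorem visible_eqToHom (h : X = Y) (φ : List Bool → Bool) : visible k (eqToHom h) φ = 0 := by
  subst h; exact visible_id φ

theorem act_comul {x : List Bool} (hx : x.length = X.word.length) : act Δ[X] x = x ++ x :=
  act_mk (Term.copy X.word) hx

theorem visible_comul (φ : List Bool → Bool) : visible k Δ[X] φ = 0 :=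
  ite_self 0

theorem act_counit {x : List Bool} (hx : x.length = X.word.length) : act ε[X] x = [] :=
  act_mk (Term.discard X.word) hx

theorem visible_counit (φ : List Bool → Bool) : visible k ε[X] φ = 0 :=
  ite_self 0

theorem act_mech (i : V) {x : List Bool} (hx : x.length = (G.pa i).length) :
    act (mech G i) x = [x.any fun b => b] :=
  act_mk (Term.mech i) hx

open scoped Classical in
theorem visible_mech (i : V) {φ : List Bool → Bool} (hφ : φ [false] = false) :
    visible k (mech G i) φ = if i = k ∧ φ [true] = true then 1 else 0 :=
  visible_mk (Term.mech i) hφ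

theorem act_pair (f : X ⟶ Y) (g : X ⟶ Z) {x : List Bool} (hx : x.length = X.word.length) :
    act (pair f g) x = act f x ++ act g x := by
  rw [pair, act_comp _ _ hx, act_comul hx, act_tensorHom f g hx hx]

theorem visible_pair (f : X ⟶ Y) (g : X ⟶ Z) {φ : List Bool → Bool}
    (hφ : φ (List.replicate (Y ⊗ Z).word.length false) = false) :
    visible k (pair f g) φ =
      visible k f (fun y => φ (y ++ List.replicate Z.word.length false)) +
        visible k g (fun y => φ (List.replicate Y.word.length false ++ y)) := by
  rw [pair, visible_comp _ _ hφ, visible_comul, visible_tensorHom f g hφ, Nat.zero_add]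

theorem act_head {c : Bool} {x : List Bool} (hx : x.length = B.length) :
    act (head G b B) (c :: x) = [c] := by
  have hc : [c].length = (of [b] : Cau G).word.length := rfl
  have h : act (𝟙 (of [b] : Cau G) ⊗ₘ ε[(of B : Cau G)]) ([c] ++ x) = [c] ++ [] := by
    rw [act_tensorHom _ _ hc hx, act_id hc, act_counit hx]
  rw [head, fst, act_comp _ _ (show (c :: x).length = (b :: B).length from congrArg Nat.succ hx), rightUnitor_hom_eq]
  exact (congrArg _ h).trans (act_eqToHom _ rfl)

theorem act_tail {c : Bool} {x : List Bool} (hx : x.length = B.length) :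
    act (tail G b B) (c :: x) = x := by
  have hc : [c].length = (of [b] : Cau G).word.length := rfl
  have h : act (ε[(of [b] : Cau G)] ⊗ₘ 𝟙 (of B : Cau G)) ([c] ++ x) = [] ++ x := by
    rw [act_tensorHom _ _ hc hx, act_id hx, act_counit hc]
  rw [tail, snd, act_comp _ _ (show (c :: x).length = (b :: B).length from congrArg Nat.succ hx), leftUnitor_hom_eq]
  exact (congrArg _ h).trans (act_eqToHom _ hx)

theorem visible_head {φ : List Bool → Bool} (hφ : φ [false] = false) :
    visible k (head G b B) φ = 0 := by
  rw [head, fst, visible_comp _ _ hφ, rightUnitor_hom_eq, visible_eqToHom, visible_tensorHom,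
    visible_id, visible_counit]
  exact (congrArg φ (act_replicate _)).trans hφ

theorem visible_tail {φ : List Bool → Bool} (hφ : φ (List.replicate B.length false) = false) :
    visible k (tail G b B) φ = 0 := by
  rw [tail, snd, visible_comp _ _ hφ, leftUnitor_hom_eq, visible_eqToHom, visible_tensorHom,
    visible_id, visible_counit]
  exact (congrArg φ (act_replicate (X := 𝟙_ (Cau G) ⊗ of B) _)).trans hφ

theorem act_proj (ψ : V → Bool) : ∀ (A : List V) (h : b ∈ A), act (proj G b A h) (A.map ψ) = [ψ b]
  | [], h => absurd h List.not_mem_nil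
  | a :: A, h => by
    by_cases hab : a = b
    · subst hab
      rw [proj_cons_self]
      exact act_head (List.length_map ψ)
    · have h' := (List.mem_cons.1 h).resolve_left (Ne.symm hab)
      rw [proj_cons_of_ne h hab h', act_comp _ _ (List.length_map ψ), List.map_cons,
        act_tail (List.length_map ψ), act_proj ψ A h']

theorem visible_proj {φ : List Bool → Bool} (hφ : φ [false] = false) :
    ∀ (A : List V) (h : b ∈ A), visible k (proj G b A h) φ = 0
  | [], h => absurd h List.not_mem_nil
  | a :: A, h => by
    by_cases hab : a = b
    · subst hab
      rw [proj_cons_self, visible_head hφ]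
    · have h' := (List.mem_cons.1 h).resolve_left (Ne.symm hab)
      rw [proj_cons_of_ne h hab h', visible_comp _ _ hφ, visible_proj hφ A h', visible_tail]
      exact (congrArg φ (act_replicate _)).trans hφ

theorem act_multiplier (ψ : V → Bool) (A : List V) :
    ∀ (B : List V) (h : B ⊆ A), act (multiplier G A B h) (A.map ψ) = B.map ψ
  | [], _ => act_counit (X := of A) (List.length_map ψ)
  | b :: B, h => by
    rw [multiplier_cons]
    refine (act_pair _ _ (List.length_map ψ)).trans ?_
    rw [act_proj, act_multiplier ψ A B]
    rfl

theorem visible_multiplier (A : List V) : ∀ (B : List V) (h : B ⊆ A) {φ : List Bool → Bool},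
    φ (List.replicate B.length false) = false → visible k (multiplier G A B h) φ = 0
  | [], _, φ, _ => visible_counit φ
  | b :: B, h, φ, hφ => by
    rw [multiplier_cons]
    refine (visible_pair _ _ hφ).trans ?_
    rw [visible_proj, visible_multiplier A B]
    · exact hφ
    · exact hφ

theorem act_step (ψ : V → Bool) (i : V) (s : List V) (h : G.pa i ⊆ s) :
    act (step i s h) (s.map ψ) = (G.pa i).any ψ :: s.map ψ := by
  refine (act_pair _ _ (List.length_map ψ)).trans ?_
  rw [act_id (List.length_map ψ), act_comp _ _ (List.length_map ψ), act_multiplier,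
    act_mech i (List.length_map ψ), List.any_map]
  rfl

open scoped Classical in
theorem visible_step (i : V) (s : List V) (h : G.pa i ⊆ s) {φ : List Bool → Bool}
    (hφ : φ (List.replicate (i :: s).length false) = false) :
    visible k (step i s h) φ =
      if i = k ∧ φ (true :: List.replicate s.length false) = true then 1 else 0 := by
  refine (visible_pair _ _ hφ).trans ?_
  have h₁ := visible_comp (k := k) (multiplier G s (G.pa i) h) (mech G i)
    (φ := fun y => φ (y ++ List.replicate s.length false)) hφ
  refine (congrArg₂ (· + ·) h₁ (visible_id _)).trans ?_
  rw [visible_multiplier, visible_mech]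
  · simp
  · exact hφ
  · exact (congrArg (fun y => φ (y ++ _)) (act_replicate (mech G i))).trans hφ

end Cau

namespace CausalGraph

open Cau

variable {V : Type u₀} {G : CausalGraph V} {k : V}

theorem exists_act_flow : ∀ (L s : List V) (h : G.Applicable s L) (ψ : V → Bool),
    (L ++ s).Nodup → ∃ ψ' : V → Bool, (∀ x ∈ s, ψ' x = ψ x) ∧
      ∀ (T : List V) (hT : T ⊆ L.reverse ++ s), act (flow L s T h hT) (s.map ψ) = T.map ψ'
  | [], s, h, ψ, _ => ⟨ψ, fun _ _ => rfl, fun T hT => by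
      rw [flow_nil s T]
      exact act_multiplier ψ s T hT⟩
  | i :: L, s, h, ψ, hn => by
    classical
    have hs : s.Nodup := List.Nodup.of_append_right hn
    have hn₁ : (L ++ i :: s).Nodup := by
      rwa [List.nodup_middle]
    have hi : i ∉ s := fun hi => (List.nodup_cons.1 hn).1 (List.mem_append_right _ hi)
    have hup : ∀ x ∈ s, Function.update ψ i ((G.pa i).any ψ) x = ψ x := fun x hx =>
      Function.update_of_ne (ne_of_mem_of_not_mem hx hi) _ _
    obtain ⟨ψ', h₁, h₂⟩ := exists_act_flow L (i :: s) h.of_cons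
      (Function.update ψ i ((G.pa i).any ψ)) hn₁
    refine ⟨ψ', fun x hx => (h₁ x (List.mem_cons_of_mem _ hx)).trans (hup x hx), fun T hT => ?_⟩
    rw [flow_cons i L s T hs, act_comp _ _ (List.length_map ψ), act_step, ← h₂,
      List.map_cons, Function.update_self, List.map_congr_left hup]

theorem act_flow (ψ : V → Bool) : ∀ (L s T : List V) (h : G.Applicable s L)
    (hT : T ⊆ L.reverse ++ s), (L ++ s).Nodup → (∀ i ∈ L, ψ i = (G.pa i).any ψ) →
      act (flow L s T h hT) (s.map ψ) = T.map ψ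
  | [], s, T, h, hT, _, _ => by
    rw [flow_nil s T]
    exact act_multiplier ψ s T hT
  | i :: L, s, T, h, hT, hn, hψ => by
    have hs : s.Nodup := List.Nodup.of_append_right hn
    have hn₁ : (L ++ i :: s).Nodup := by
      rwa [List.nodup_middle]
    rw [flow_cons i L s T hs, act_comp _ _ (List.length_map ψ), act_step,
      ← hψ i List.mem_cons_self, ← List.map_cons]
    exact act_flow ψ L (i :: s) T _ _ hn₁ fun j hj => hψ j (List.mem_cons_of_mem _ hj)

open scoped Classical in
theorem visible_flow_le : ∀ (L s T : List V) (h : G.Applicable s L) (hT : T ⊆ L.reverse ++ s)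
    (φ : List Bool → Bool), φ (List.replicate T.length false) = false → (L ++ s).Nodup →
      visible k (flow L s T h hT) φ ≤ L.count k
  | [], s, T, h, hT, φ, hφ, _ => by
    rw [flow_nil s T]
    exact (visible_multiplier s T hT hφ).le
  | i :: L, s, T, h, hT, φ, hφ, hn => by
    have hs : s.Nodup := List.Nodup.of_append_right hn
    have hn₁ : (L ++ i :: s).Nodup := by
      rwa [List.nodup_middle]
    rw [flow_cons i L s T hs, visible_comp _ _ hφ, visible_step, List.count_cons, Nat.add_comm]
    · refine Nat.add_le_add (visible_flow_le L (i :: s) T _ _ φ hφ hn₁) ?_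
      by_cases hik : i = k
      · simp only [hik, beq_self_eq_true, if_true]
        split_ifs <;> omega
      · simp [hik]
    · exact (congrArg φ (act_replicate (flow L (i :: s) T _ _))).trans hφ

/-- The noise of a mechanism is visible if its response is. -/
theorem visible_flow_pos (ψ : V → Bool) (hk : ψ k = true) : ∀ (L s T : List V)
    (h : G.Applicable s L) (hT : T ⊆ L.reverse ++ s) (φ : List Bool → Bool),
    φ (List.replicate T.length false) = false → (L ++ s).Nodup → k ∈ L →
    (∀ x ∈ s, ψ x = false) → (∀ i ∈ L, i ≠ k → ψ i = (G.pa i).any ψ) → φ (T.map ψ) = true →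
      0 < visible k (flow L s T h hT) φ
  | [], _, _, _, _, _, _, _, hkL, _, _, _ => absurd hkL List.not_mem_nil
  | i :: L, s, T, h, hT, φ, hφ, hn, hkL, hs₀, hψ, hT₁ => by
    have hs : s.Nodup := List.Nodup.of_append_right hn
    have hn₁ : (L ++ i :: s).Nodup := by
      rwa [List.nodup_middle]
    rw [flow_cons i L s T hs, visible_comp _ _ hφ]
    by_cases hik : i = k
    · subst hik
      have hiL : i ∉ L := fun hi => (List.nodup_cons.1 hn).1 (List.mem_append_left _ hi)
      have hzero : List.replicate s.length false = s.map ψ := by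
        rw [List.map_congr_left hs₀, List.map_const']
      rw [visible_step, if_pos]
      · omega
      · refine ⟨rfl, ?_⟩
        rw [hzero, show true :: s.map ψ = (i :: s).map ψ by rw [List.map_cons, hk],
          act_flow ψ L (i :: s) T _ _ hn₁, hT₁]
        exact fun j hj => hψ j (List.mem_cons_of_mem _ hj) (fun e => hiL (e ▸ hj))
      · exact (congrArg φ (act_replicate (flow L (i :: s) T _ _))).trans hφ
    · refine Nat.add_pos_right _ (visible_flow_pos ψ hk L (i :: s) T _ _ φ hφ hn₁
        ((List.mem_cons.1 hkL).resolve_left (Ne.symm hik)) ?_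
        (fun j hj => hψ j (List.mem_cons_of_mem _ hj)) hT₁)
      refine List.forall_mem_cons.2 ⟨?_, hs₀⟩
      rw [hψ i List.mem_cons_self hik, List.any_eq_false]
      exact fun x hx => by simp [hs₀ x (h.pa_subset hx)]

theorem Reaches.iff_eq_or_parent {t : List V} {x y : V} (hy : y ∉ t) :
    G.Reaches t x y ↔ y = x ∨ ∃ z ∈ G.pa y, G.Reaches t x z := by
  refine Relation.ReflTransGen.cases_tail_iff _ _ _ |>.trans (or_congr Iff.rfl ?_)
  constructor
  · rintro ⟨z, hz, hzy⟩
    exact ⟨z, G.mem_pa.2 hzy.1, hz⟩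
  · rintro ⟨z, hzy, hz⟩
    exact ⟨z, hz, G.mem_pa.1 hzy, hy⟩

theorem Reaches.not_mem {t : List V} {x y : V} (h : G.Reaches t x y) (hx : x ∉ t) : y ∉ t := by
  rcases Relation.ReflTransGen.cases_tail h with rfl | ⟨_, _, h⟩
  · exact hx
  · exact h.2

variable [Finite V] {u v w : List V}

/-- In a causal effect the noise of every node is visible at the outputs reached from it. -/
theorem visible_flow_effectNodes_pos {t s T : List V} (ht : t.Nodup) (hk : k ∈ G.effectNodes t s)
    (hT : T ⊆ (G.effectNodes t s).reverse ++ t) {φ : List Bool → Bool}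
    (hφ : φ (List.replicate T.length false) = false)
    (h : ∀ ψ : V → Bool, (∀ x, G.Reaches t k x → ψ x = true) → φ (T.map ψ) = true) :
    0 < visible k (flow (G.effectNodes t s) t T (G.applicable_effectNodes t s) hT) φ := by
  classical
  have hkt := (mem_effectNodes.1 hk).2
  refine visible_flow_pos (fun x => decide (G.Reaches t k x)) ?_ _ t T _ hT φ hφ
    (nodup_effectNodes_append t s ht) hk (fun x hx => ?_) (fun i hi hik => ?_) (h _ ?_)
  · exact decide_eq_true Relation.ReflTransGen.refl
  · simpa using fun h : G.Reaches t k x => h.not_mem hkt hx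
  · rw [Bool.eq_iff_iff, decide_eq_true_iff, List.any_eq_true,
      Reaches.iff_eq_or_parent (mem_effectNodes.1 hi).2, or_iff_right hik]
    simp
  · exact fun x hx => by simpa using hx

theorem disjoint_of_decomposable (hu : u.Nodup) (hv : v.Nodup) (huv : u.Disjoint v)
    (h : G.Decomposable u v w) :
    (G.effectNodes u v).Disjoint (G.effectNodes (v ++ u) w) := by
  classical
  intro k hkA hkB
  have hvu : (v ++ u).Nodup := hv.append hu huv.symm
  have hB := nodup_effectNodes_append (G := G) (v ++ u) w hvu
  have hC := nodup_effectNodes_append (G := G) u (v ++ w) hu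
  let φ : List Bool → Bool := fun x => x.any fun b => b
  have hφ : ∀ n, φ (List.replicate n false) = false := fun n => by simp [φ]
  have hφ' : ∀ {T : List V} {ψ : V → Bool} {x : V}, x ∈ T → ψ x = true → φ (T.map ψ) = true :=
    fun {T ψ x} hx h => by
      simp only [φ, List.any_map, List.any_eq_true]
      exact ⟨x, hx, h⟩
  rw [decomposable_iff hu hv huv] at h
  have h₁ : visible k (G.effect (v ++ w) u) φ ≤ 1 :=
    (visible_flow_le _ u (v ++ w) _ (G.subset_effectNodes u (v ++ w)) φ (hφ _) hC).trans
      (List.nodup_iff_count_le_one.1 (List.Nodup.of_append_left hC) k)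
  rw [h, visible_comp _ _ (hφ _)] at h₁
  obtain ⟨-, i, hi, hki⟩ := mem_effectNodes_iff.1 hkA
  obtain ⟨-, j, hj, hkj⟩ := mem_effectNodes_iff.1 hkB
  have h₂ := visible_flow_effectNodes_pos hvu hkB (append_subset_effectNodes u v w) (hφ _)
    fun ψ hψ => hφ' (List.mem_append_right v hj) (hψ j hkj)
  have h₃ := visible_flow_effectNodes_pos hu hkA (subset_effectNodes_append u v)
    (φ := fun y => φ (act (flow (G.effectNodes (v ++ u) w) (v ++ u) (v ++ w)
      (G.applicable_effectNodes (v ++ u) w) (append_subset_effectNodes u v w)) y))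
    ((congrArg φ (act_replicate _)).trans (hφ _)) fun ψ hψ => by
      obtain ⟨ψ', hψ', hact⟩ := exists_act_flow (G.effectNodes (v ++ u) w) (v ++ u)
        (G.applicable_effectNodes (v ++ u) w) ψ hB
      rw [hact]
      exact hφ' (List.mem_append_left w hi)
        ((hψ' i (List.mem_append_left u hi)).trans (hψ i hki))
  omega

end CausalGraph

theorem mainTheorem1 {V : Type*} [Finite V] (G : CausalGraph V) (u v w : List V)
    (hu : u.Nodup) (hv : v.Nodup) (hw : w.Nodup)
    (huv : u.Disjoint v) (huw : u.Disjoint w) (hvw : v.Disjoint w) :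
    G.Decomposable u v w ↔
      G.BackwardTSeparated {x | x ∈ v} {x | x ∈ w} {x | x ∈ u} :=
  ⟨fun h => CausalGraph.backwardTSeparated_of_disjoint hvw
      (CausalGraph.disjoint_of_decomposable hu hv huv h),
    fun h => CausalGraph.decomposable_of_perm hu hv huv
      (CausalGraph.perm_effectNodes (CausalGraph.disjoint_of_backwardTSeparated h))⟩
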